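/- Let $R\in\mathbb R^{n\times n}$ be a density matrix (symmetric positive semidefinite, $\operatorname{tr}R=1$) whose eigenvalues $p_1,\dots,p_n$ (listed with multiplicity) all satisfy $p_i\ge \ell>0$, let $\mathcal H(R)=-\sum_{i=1}^n p_i\ln p_i$ be its von Neumann entropy, let $0<\epsilon<1$ and $0<\delta<1$, and let $\mathrm{nnz}(R)$ be the number of nonzero entries of $R$. Consider the following randomized algorithm. 1. (Power method.) Put $q=\lceil 4.82\ln(1/\delta)\rceil$ and $t=\lceil \ln\sqrt{4n}\,\rceil$. Draw $q$ independent uniformly random vectors $x^1,\dots,x^q\in\{-1,1\}^n$, put $y^j=R^t x^j$ (computed by $t$ successive multiplications by $R$), and set $$\tilde p_1=\max_{1\le j\le q}\frac{(y^j)^\top R\,y^j}{(y^j)^\top y^j}.$$ 2. Set $u=\min\{1,6\tilde p_1\}$, $m=\left\lceil \frac u\ell\ln\frac1\epsilon\right\rceil$ and $s=\lceil 20\ln(2/\delta)/\epsilon^2\rceil$. 3. Draw independent standard Gaussian vectors $g_1,\dots,g_s\in\mathbb R^n$, independent of the $x^j$, and output $$\widehat{\mathcal H}(R)=\ln u^{-1}+\frac1s\sum_{i=1}^s\sum_{k=1}^m\frac{g_i^\top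 R\,(I_n-u^{-1}R)^k g_i}{k}.$$ Then: (a) With probability at least $1-2\delta$, $\ \bigl|\widehat{\mathcal H}(R)-\mathcal H(R)\bigr|\le 2\epsilon\,\mathcal H(R)$. (b) On a real RAM (unit cost for each arithmetic operation, natural logarithm, ceiling, comparison, memory access, random sign and Gaussian draw; $R$ given as a list of its nonzero entries with their positions, in any order), a single program, the same for all inputs, carries out the algorithm and outputs exactly $\widehat{\mathcal H}(R)$ for every outcome of the random draws. Its running time is $$O\!\left(\left(\frac u\ell\cdot\frac{\ln(1/\epsilon)}{\epsilon^2}+\ln n\right)\ln(1/\delta)\;\mathrm{nnz}(R)\right)$$ for every outcome of the random draws, in the following sense: for every $c<1$ there is a constant $C$, depending only on $c$, such that the running time is at most $C$ times the expression in parentheses for all $n,R,\ell,\epsilon,\delta$ as above with $\delta\le c$ and with $n\ge2$ or $\epsilon\le c$. -/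

import Mathlib

open MeasureTheory ProbabilityTheory Matrix

namespace EntropyTaylor

noncomputable section

/-! ### Density matrices, entropy, sparsity -/

/-- A real density matrix: symmetric positive semidefinite with unit trace. -/
structure IsDensityMatrix {n : ℕ} (R : Matrix (Fin n) (Fin n) ℝ) : Prop where
  posSemidef : R.PosSemidef
  trace_eq_one : R.trace = 1

/-- The eigenvalues ("probabilities") of a density matrix, with multiplicity. -/
def IsDensityMatrix.prob {n : ℕ} {R : Matrix (Fin n) (Fin n) ℝ} (hR : IsDensityMatrix R) :
    Fin n → ℝ :=
  hR.posSemidef.isHermitian.eigenvalues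

/-- The von Neumann entropy `-∑ i, p i * ln (p i)` (with `0 * ln 0 = 0`). -/
def IsDensityMatrix.entropy {n : ℕ} {R : Matrix (Fin n) (Fin n) ℝ} (hR : IsDensityMatrix R) : ℝ :=
  -∑ i, hR.prob i * Real.log (hR.prob i)

/-- The positions of the nonzero entries of a matrix. -/
abbrev NonzeroPos {n : ℕ} (R : Matrix (Fin n) (Fin n) ℝ) : Type :=
  {p : Fin n × Fin n // R p.1 p.2 ≠ 0}

/-- The number of nonzero entries of a matrix. -/
def nnz {n : ℕ} (R : Matrix (Fin n) (Fin n) ℝ) : ℕ := Nat.card (NonzeroPos R)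

/-! ### The power method -/

/-- The Rayleigh quotient `vᵀ A v / vᵀ v`. -/
def rayleigh {n : ℕ} (A : Matrix (Fin n) (Fin n) ℝ) (v : Fin n → ℝ) : ℝ :=
  (v ⬝ᵥ A *ᵥ v) / (v ⬝ᵥ v)

/-- Power method with `t` steps from each of the `q` starting vectors `x j`: the largest of the
`q` Rayleigh quotients at the final iterates. -/
def powerEstimate {n : ℕ} (A : Matrix (Fin n) (Fin n) ℝ) (q t : ℕ) (x : Fin q → Fin n → ℝ) : ℝ :=
  ⨆ j : Fin q, rayleigh A ((fun v => A *ᵥ v)^[t] (x j))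

/-- The number of repetitions of the power method, `⌈4.82 ln (1/δ)⌉`. -/
def powerReps (δ : ℝ) : ℕ := ⌈(4.82 : ℝ) * Real.log (1 / δ)⌉₊

/-- The number of steps of the power method, `⌈ln √(4n)⌉`. -/
def powerSteps (n : ℕ) : ℕ := ⌈Real.log (Real.sqrt (4 * (n : ℝ)))⌉₊

/-! ### The Taylor-series estimator -/

/-- `u = min {1, 6 p̃₁}`. -/
def upperEstimate {n : ℕ} (R : Matrix (Fin n) (Fin n) ℝ) (δ : ℝ)
    (x : Fin (powerReps δ) → Fin n → ℝ) : ℝ :=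
  min 1 (6 * powerEstimate R (powerReps δ) (powerSteps n) x)

/-- The number of Gaussian vectors, `s = ⌈20 ln (2/δ) / ε²⌉`. -/
def numGaussians (ε δ : ℝ) : ℕ := ⌈20 * Real.log (2 / δ) / ε ^ 2⌉₊

/-- The number of Taylor terms, `m = ⌈(u/ℓ) ln (1/ε)⌉`. -/
def numTerms (u ℓ ε : ℝ) : ℕ := ⌈u / ℓ * Real.log (1 / ε)⌉₊

/-- `ln u⁻¹ + (1/s) ∑_{i ≤ s} ∑_{k=1}^m gᵢᵀ R (I - u⁻¹ R)ᵏ gᵢ / k`. -/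
def taylorSum {n : ℕ} (R : Matrix (Fin n) (Fin n) ℝ) (u : ℝ) (m s : ℕ)
    (g : Fin s → Fin n → ℝ) : ℝ :=
  Real.log u⁻¹ + (1 / (s : ℝ)) * ∑ i : Fin s, ∑ k ∈ Finset.Icc 1 m,
    (g i ⬝ᵥ (R * (1 - u⁻¹ • R) ^ k) *ᵥ g i) / (k : ℝ)

/-- The output of the Taylor-series algorithm on starting vectors `x` and Gaussian vectors `g`. -/
def estimate {n : ℕ} (R : Matrix (Fin n) (Fin n) ℝ) (ℓ ε δ : ℝ)
    (x : Fin (powerReps δ) → Fin n → ℝ) (g : Fin (numGaussians ε δ) → Fin n → ℝ) : ℝ :=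
  taylorSum R (upperEstimate R δ x) (numTerms (upperEstimate R δ x) ℓ ε) (numGaussians ε δ) g

/-! ### Randomness -/

/-- A source of randomness: a sequence of coin flips and a sequence of real numbers. -/
abbrev Tape : Type := (ℕ → Bool) × (ℕ → ℝ)

/-- All coin flips are fair, all reals are standard Gaussian, and everything is independent. -/
def tapeMeasure : Measure Tape :=
  (Measure.infinitePi fun _ : ℕ => uniformOn (Set.univ : Set Bool)).prod
    (Measure.infinitePi fun _ : ℕ => gaussianReal 0 1)

/-- The random sign carried by a coin flip. -/
def signOf (b : Bool) : ℝ := if b then 1 else -1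

/-- The `j`-th random sign vector of length `n`: the `j`-th block of `n` coin flips. -/
def signVec (n : ℕ) (ω : Tape) (j : ℕ) : Fin n → ℝ := fun i => signOf (ω.1 (j * n + i))

/-- The `j`-th Gaussian vector of length `n`: the `j`-th block of `n` Gaussians. -/
def gaussVec (n : ℕ) (ω : Tape) (j : ℕ) : Fin n → ℝ := fun i => ω.2 (j * n + i)

/-- The random `u` of the algorithm. -/
def randomUpper {n : ℕ} (R : Matrix (Fin n) (Fin n) ℝ) (δ : ℝ) (ω : Tape) : ℝ :=
  upperEstimate R δ fun j => signVec n ω j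

/-- The random output of the algorithm. -/
def randomEstimate {n : ℕ} (R : Matrix (Fin n) (Fin n) ℝ) (ℓ ε δ : ℝ) (ω : Tape) : ℝ :=
  estimate R ℓ ε δ (fun j => signVec n ω j) (fun j => gaussVec n ω j)

/-! ### A randomized real RAM with a step count

The memory consists of arrays of natural numbers and arrays of real numbers, each array being
addressed by a fixed number in the program text. Programs are finite objects built from
assignments, random draws, sequencing, branching and counted loops. Every arithmetic operation,
logarithm, ceiling, comparison, constant, memory access, random draw and loop iteration
costs one time unit. -/

/-- The state of the machine. -/
structure State where
  /-- `nat a i` is the `i`-th cell of the `a`-th array of natural numbers. -/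
  nat : ℕ → ℕ → ℕ
  /-- `real a i` is the `i`-th cell of the `a`-th array of reals. -/
  real : ℕ → ℕ → ℝ
  /-- The number of coin flips used so far. -/
  flips : ℕ
  /-- The number of Gaussians used so far. -/
  gaussians : ℕ
  /-- The number of time units used so far. -/
  time : ℕ

/-- Store a natural number. -/
def State.setNat (σ : State) (a i v : ℕ) : State :=
  { σ with nat := Function.update σ.nat a (Function.update (σ.nat a) i v) }

/-- Store a real number. -/
def State.setReal (σ : State) (a i : ℕ) (v : ℝ) : State :=
  { σ with real := Function.update σ.real a (Function.update (σ.real a) i v) }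

/-- Let `k` time units pass. -/
def State.tick (σ : State) (k : ℕ) : State := { σ with time := σ.time + k }

/-- Expressions for natural numbers (indices and counters). -/
inductive NatExpr : Type
  | const (k : ℕ)
  | get (a : ℕ) (i : NatExpr)
  | add (e f : NatExpr)

/-- The value of an expression. -/
def NatExpr.eval (σ : State) : NatExpr → ℕ
  | const k => k
  | get a i => σ.nat a (i.eval σ)
  | add e f => e.eval σ + f.eval σ

/-- The cost of an expression: the number of its nodes. -/
def NatExpr.cost : NatExpr → ℕ
  | const _ => 1
  | get _ i => i.cost + 1
  | add e f => e.cost + f.cost + 1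

/-- Expressions for real numbers. Constants are rational. -/
inductive RealExpr : Type
  | const (c : ℚ)
  | ofNat (e : NatExpr)
  | get (a : ℕ) (i : NatExpr)
  | add (e f : RealExpr)
  | sub (e f : RealExpr)
  | mul (e f : RealExpr)
  | div (e f : RealExpr)
  | log (e : RealExpr)

/-- The value of an expression. -/
def RealExpr.eval (σ : State) : RealExpr → ℝ
  | const c => (c : ℝ)
  | ofNat e => (e.eval σ : ℝ)
  | get a i => σ.real a (i.eval σ)
  | add e f => e.eval σ + f.eval σ
  | sub e f => e.eval σ - f.eval σ
  | mul e f => e.eval σ * f.eval σ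
  | div e f => e.eval σ / f.eval σ
  | log e => Real.log (e.eval σ)

/-- The cost of an expression: the number of its nodes. -/
def RealExpr.cost : RealExpr → ℕ
  | const _ => 1
  | ofNat e => e.cost + 1
  | get _ i => i.cost + 1
  | add e f => e.cost + f.cost + 1
  | sub e f => e.cost + f.cost + 1
  | mul e f => e.cost + f.cost + 1
  | div e f => e.cost + f.cost + 1
  | log e => e.cost + 1

/-- Programs. -/
inductive Program : Type
  /-- Do nothing. -/
  | skip
  /-- Store a natural number in cell `i` of the `a`-th array of natural numbers. -/
  | setNat (a : ℕ) (i e : NatExpr)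
  /-- Store a real number in cell `i` of the `a`-th array of reals. -/
  | setReal (a : ℕ) (i : NatExpr) (e : RealExpr)
  /-- Store the ceiling of a real number (zero if it is negative) as a natural number. -/
  | setCeil (a : ℕ) (i : NatExpr) (e : RealExpr)
  /-- Store a fresh random sign in an array of reals. -/
  | drawSign (a : ℕ) (i : NatExpr)
  /-- Store a fresh standard Gaussian in an array of reals. -/
  | drawGaussian (a : ℕ) (i : NatExpr)
  /-- Run one program after another. -/
  | seq (p p' : Program)
  /-- If `e ≤ f` run `p`, otherwise run `p'`. -/
  | ifLe (e f : RealExpr) (p p' : Program)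
  /-- Evaluate `b` once, then run `p` that many times, with the counter `0, 1, …` in cell `0` of
  the `a`-th array of natural numbers. -/
  | loop (a : ℕ) (b : NatExpr) (p : Program)

/-- The effect of a program on the state, including the time used. -/
def Program.run (ω : Tape) : Program → State → State
  | skip, σ => σ.tick 1
  | setNat a i e, σ => (σ.setNat a (i.eval σ) (e.eval σ)).tick (i.cost + e.cost + 1)
  | setReal a i e, σ => (σ.setReal a (i.eval σ) (e.eval σ)).tick (i.cost + e.cost + 1)
  | setCeil a i e, σ => (σ.setNat a (i.eval σ) ⌈e.eval σ⌉₊).tick (i.cost + e.cost + 1)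
  | drawSign a i, σ =>
      ({ σ.setReal a (i.eval σ) (signOf (ω.1 σ.flips)) with
          flips := σ.flips + 1 } : State).tick (i.cost + 1)
  | drawGaussian a i, σ =>
      ({ σ.setReal a (i.eval σ) (ω.2 σ.gaussians) with
          gaussians := σ.gaussians + 1 } : State).tick (i.cost + 1)
  | seq p p', σ => p'.run ω (p.run ω σ)
  | ifLe e f p p', σ =>
      open Classical in
      if e.eval σ ≤ f.eval σ then p.run ω (σ.tick (e.cost + f.cost + 1))
      else p'.run ω (σ.tick (e.cost + f.cost + 1))
  | loop a b p, σ =>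
      Nat.rec (motive := fun _ => State) (σ.tick (b.cost + 1))
        (fun k τ => p.run ω ((τ.setNat a 0 k).tick 1)) (b.eval σ)

/-- The input, with the matrix in sparse coordinate format for the enumeration `e` of its nonzero
entries: natural arrays `0 ↦ (n, nnz R)`, `1 ↦` row indices, `2 ↦` column indices; real arrays
`0 ↦ (ℓ, ε, δ)`, `1 ↦` values of the nonzero entries. Everything else is zero. -/
def inputState {n : ℕ} (R : Matrix (Fin n) (Fin n) ℝ) (e : Fin (nnz R) ≃ NonzeroPos R)
    (ℓ ε δ : ℝ) : State where
  nat := fun a i => match a with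
    | 0 => if i = 0 then n else if i = 1 then nnz R else 0
    | 1 => if h : i < nnz R then ((e ⟨i, h⟩).1.1 : ℕ) else 0
    | 2 => if h : i < nnz R then ((e ⟨i, h⟩).1.2 : ℕ) else 0
    | _ => 0
  real := fun a i => match a with
    | 0 => if i = 0 then ℓ else if i = 1 then ε else if i = 2 then δ else 0
    | 1 => if h : i < nnz R then R (e ⟨i, h⟩).1.1 (e ⟨i, h⟩).1.2 else 0
    | _ => 0
  flips := 0
  gaussians := 0
  time := 0

/-! ### The Taylor-series algorithm as a program

Layout of the memory, besides the input: the natural arrays `3`, `4`, `5` are loop counters and the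
natural array `6` holds `(q, t, s, m)`. The real arrays `2`, `3`, `4` are vectors of length `n`, and
the real array `5` holds the scalars `(p̃₁, scratch, scratch, u, accumulator)`. -/

/-- Run a list of programs one after another. -/
def block : List Program → Program
  | [] => .skip
  | p :: ps => .seq p (block ps)

/-- The cell with the fixed index `i` of a natural array. -/
abbrev nCell (a i : ℕ) : NatExpr := .get a (.const i)

/-- The cell with the fixed index `i` of a real array. -/
abbrev rCell (a i : ℕ) : RealExpr := .get a (.const i)

/-- Set the vector `dst` to `R` times the vector `src`, using the nonzero entries of `R` only. -/
def matVec (src dst : ℕ) : Program :=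
  block [
    .loop 5 (nCell 0 0) (.setReal dst (nCell 5 0) (.const 0)),
    .loop 5 (nCell 0 1)
      (.setReal dst (.get 1 (nCell 5 0))
        (.add (.get dst (.get 1 (nCell 5 0)))
          (.mul (.get 1 (nCell 5 0)) (.get src (.get 2 (nCell 5 0))))))]

/-- Store the inner product of the vectors `a` and `b` in the scalar cell `c`. -/
def dotInto (a b c : ℕ) : Program :=
  block [
    .setReal 5 (.const c) (.const 0),
    .loop 5 (nCell 0 0)
      (.setReal 5 (.const c)
        (.add (rCell 5 c) (.mul (.get a (nCell 5 0)) (.get b (nCell 5 0)))))]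

/-- Set `q = ⌈4.82 ln (1/δ)⌉`, `t = ⌈ln (4n) / 2⌉` and `s = ⌈20 ln (2/δ) / ε²⌉`. -/
def setParameters : Program :=
  block [
    .setCeil 6 (.const 0) (.mul (.const (482 / 100)) (.log (.div (.const 1) (rCell 0 2)))),
    .setCeil 6 (.const 1)
      (.div (.log (.mul (.const 4) (.ofNat (nCell 0 0)))) (.const 2)),
    .setCeil 6 (.const 2)
      (.div (.mul (.const 20) (.log (.div (.const 2) (rCell 0 2))))
        (.mul (rCell 0 1) (rCell 0 1)))]

/-- The power method, repeated `q` times. All Rayleigh quotients are nonnegative, so the running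
maximum may start from zero. -/
def powerProgram : Program :=
  block [
    .setReal 5 (.const 0) (.const 0),
    .loop 3 (nCell 6 0) (block [
      .loop 5 (nCell 0 0) (.drawSign 2 (nCell 5 0)),
      .loop 4 (nCell 6 1) (block [
        matVec 2 3,
        .loop 5 (nCell 0 0) (.setReal 2 (nCell 5 0) (.get 3 (nCell 5 0)))]),
      matVec 2 3,
      dotInto 2 3 1,
      dotInto 2 2 2,
      .setReal 5 (.const 1) (.div (rCell 5 1) (rCell 5 2)),
      .ifLe (rCell 5 0) (rCell 5 1) (.setReal 5 (.const 0) (rCell 5 1)) .skip])]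

/-- Set `u = min {1, 6 p̃₁}` and `m = ⌈(u/ℓ) ln (1/ε)⌉`. -/
def setUpper : Program :=
  block [
    .setReal 5 (.const 3) (.mul (.const 6) (rCell 5 0)),
    .ifLe (.const 1) (rCell 5 3) (.setReal 5 (.const 3) (.const 1)) .skip,
    .setCeil 6 (.const 3)
      (.mul (.div (rCell 5 3) (rCell 0 0)) (.log (.div (.const 1) (rCell 0 1))))]

/-- Accumulate `∑ᵢ ∑ₖ gᵢᵀ R (I - u⁻¹ R)ᵏ gᵢ / k`: for each Gaussian vector `g` the vector `R g` is
kept, and `y = (I - u⁻¹ R)ᵏ g` is updated by one product with `R` per Taylor term. -/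
def traceProgram : Program :=
  block [
    .setReal 5 (.const 4) (.const 0),
    .loop 3 (nCell 6 2) (block [
      .loop 5 (nCell 0 0) (.drawGaussian 2 (nCell 5 0)),
      matVec 2 4,
      .loop 4 (nCell 6 3) (block [
        matVec 2 3,
        .loop 5 (nCell 0 0)
          (.setReal 2 (nCell 5 0)
            (.sub (.get 2 (nCell 5 0)) (.div (.get 3 (nCell 5 0)) (rCell 5 3)))),
        dotInto 4 2 1,
        .setReal 5 (.const 4)
          (.add (rCell 5 4)
            (.div (rCell 5 1) (.ofNat (.add (nCell 4 0) (.const 1)))))])])]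

/-- The Taylor-series algorithm. -/
def taylorProgram : Program :=
  block [
    setParameters,
    powerProgram,
    setUpper,
    traceProgram,
    .setReal 0 (.const 0)
      (.add (.log (.div (.const 1) (rCell 5 3))) (.div (rCell 5 4) (.ofNat (nCell 6 2))))]

/-- The final state of a program on an input. The output is cell `0` of the real array `0`. -/
def Program.final (P : Program) {n : ℕ} (R : Matrix (Fin n) (Fin n) ℝ)
    (e : Fin (nnz R) ≃ NonzeroPos R) (ℓ ε δ : ℝ) (ω : Tape) : State :=
  P.run ω (inputState R e ℓ ε δ)

/-- The output of a program. -/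
def Program.output (P : Program) {n : ℕ} (R : Matrix (Fin n) (Fin n) ℝ)
    (e : Fin (nnz R) ≃ NonzeroPos R) (ℓ ε δ : ℝ) (ω : Tape) : ℝ :=
  (P.final R e ℓ ε δ ω).real 0 0

/-- The running time of a program. -/
def Program.runtime (P : Program) {n : ℕ} (R : Matrix (Fin n) (Fin n) ℝ)
    (e : Fin (nnz R) ≃ NonzeroPos R) (ℓ ε δ : ℝ) (ω : Tape) : ℕ :=
  (P.final R e ℓ ε δ ω).time

end

end EntropyTaylor

/-! Since `tr R = 1`, for every `u > 0` the entropy splits as `H = ln u⁻¹ + ∑ pᵢ (-ln (pᵢ / u))`. If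
all `pᵢ ≤ u ≤ 1`, both summands are nonnegative, and each logarithm is the series of `-ln (1 - x)`
at `x = 1 - pᵢ / u` in `[0, 1)`. Cutting this series after `m` terms loses at most the fraction `x ^
m` of its sum (`neg_log_sub_logPartial_le`), and `x ^ m ≤ ε` by the choice of `m`
(`one_sub_pow_numTerms_le`). So truncation costs at most `ε H`.

The trace of the truncated series is estimated by Gaussian quadratic forms. In the eigenbasis of `R`
these are weighted sums of independent squared Gaussians, and a Chernoff bound
(`measure_quadForm_le`) gives relative error `ε` with probability at least `1 - δ`. That trace is at
most `H`, so the total error is at most `2 ε H`.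

The bound `pᵢ ≤ u` comes from the power method. A random sign vector has squared inner product at
least `1/4` with a top eigenvector with probability at least `3/16` (`measure_sum_signs_ge`); from
such a start the Rayleigh quotient reaches a sixth of the top eigenvalue
(`IsDensityMatrix.prob_le_rayleigh`). All `q` starts fail with probability at most `(13/16) ^ q ≤
δ`. As `u` depends on the signs alone, integrating over sections gives success probability at least
`(1 - δ)² ≥ 1 - 2δ`.

For the program, loop invariants yield the exact output and explicit step counts. The counts become
the asymptotic bound because `n ≤ nnz R` (a positive definite matrix has nonzero diagonal), because
`u ≥ ℓ` holds for every outcome, and because lower bounds on `ln (1/δ)` and on the first factor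
absorb the additive constants left by the ceilings. -/

namespace EntropyTaylor

noncomputable section

/-! ### Spectral coordinates -/

section Spectral

variable {n : ℕ} {R : Matrix (Fin n) (Fin n) ℝ}

/-- The orthonormal eigenbasis of a density matrix. -/
def IsDensityMatrix.basis (hR : IsDensityMatrix R) :
    OrthonormalBasis (Fin n) ℝ (EuclideanSpace ℝ (Fin n)) :=
  hR.posSemidef.isHermitian.eigenvectorBasis

/-- The coordinates of a vector in the eigenbasis. -/
def IsDensityMatrix.coord (hR : IsDensityMatrix R) (x : Fin n → ℝ) (i : Fin n) : ℝ :=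
  (hR.basis i).ofLp ⬝ᵥ x

theorem dotProduct_mulVec_symm {A : Matrix (Fin n) (Fin n) ℝ} (hA : A.IsHermitian)
    (x y : Fin n → ℝ) : x ⬝ᵥ A *ᵥ y = (A *ᵥ x) ⬝ᵥ y := by
  have h : Aᵀ = A := by simpa [Matrix.IsHermitian, conjTranspose_eq_transpose_of_trivial] using hA
  rw [dotProduct_mulVec, ← mulVec_transpose, h]

theorem IsDensityMatrix.coord_mulVec (hR : IsDensityMatrix R) (x : Fin n → ℝ) (i : Fin n) :
    hR.coord (R *ᵥ x) i = hR.prob i * hR.coord x i := by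
  unfold coord
  rw [dotProduct_mulVec_symm hR.posSemidef.isHermitian, basis,
    hR.posSemidef.isHermitian.mulVec_eigenvectorBasis, smul_dotProduct]
  rfl

theorem IsDensityMatrix.coord_iterate (hR : IsDensityMatrix R) (t : ℕ) (x : Fin n → ℝ)
    (i : Fin n) : hR.coord ((fun v => R *ᵥ v)^[t] x) i = hR.prob i ^ t * hR.coord x i := by
  induction t generalizing x with
  | zero => simp
  | succ t ih => rw [Function.iterate_succ_apply, ih, hR.coord_mulVec]; ring

theorem IsDensityMatrix.dotProduct_eq_sum (hR : IsDensityMatrix R) (x y : Fin n → ℝ) :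
    x ⬝ᵥ y = ∑ i, hR.coord x i * hR.coord y i := by
  have h := hR.basis.sum_inner_mul_inner (WithLp.toLp 2 x) (WithLp.toLp 2 y)
  simp only [EuclideanSpace.inner_eq_star_dotProduct, star_trivial] at h
  rw [dotProduct_comm x y, ← h]
  refine Finset.sum_congr rfl fun i _ => ?_
  rw [dotProduct_comm y]
  rfl

theorem IsDensityMatrix.coord_sub_smul (hR : IsDensityMatrix R) (c : ℝ) (x : Fin n → ℝ)
    (i : Fin n) : hR.coord ((1 - c • R) *ᵥ x) i = (1 - c * hR.prob i) * hR.coord x i := by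
  have : hR.coord ((1 - c • R) *ᵥ x) i = hR.coord x i - c * hR.coord (R *ᵥ x) i := by
    simp [coord, sub_mulVec, smul_mulVec, dotProduct_sub]
  rw [this, hR.coord_mulVec]; ring

theorem IsDensityMatrix.coord_sub_smul_pow (hR : IsDensityMatrix R) (c : ℝ) (k : ℕ)
    (x : Fin n → ℝ) (i : Fin n) :
    hR.coord ((1 - c • R) ^ k *ᵥ x) i = (1 - c * hR.prob i) ^ k * hR.coord x i := by
  induction k with
  | zero => simp
  | succ k ih => rw [pow_succ', ← mulVec_mulVec, hR.coord_sub_smul, ih]; ring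

theorem IsDensityMatrix.quadForm_eq_sum (hR : IsDensityMatrix R) (c : ℝ) (k : ℕ)
    (x : Fin n → ℝ) : x ⬝ᵥ (R * (1 - c • R) ^ k) *ᵥ x
      = ∑ i, hR.prob i * (1 - c * hR.prob i) ^ k * hR.coord x i ^ 2 := by
  rw [hR.dotProduct_eq_sum]
  refine Finset.sum_congr rfl fun i _ => ?_
  rw [← mulVec_mulVec, hR.coord_mulVec, hR.coord_sub_smul_pow]; ring

theorem IsDensityMatrix.prob_nonneg (hR : IsDensityMatrix R) (i : Fin n) : 0 ≤ hR.prob i :=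
  hR.posSemidef.eigenvalues_nonneg i

theorem IsDensityMatrix.sum_prob (hR : IsDensityMatrix R) : ∑ i, hR.prob i = 1 := by
  have := hR.posSemidef.isHermitian.trace_eq_sum_eigenvalues
  rw [hR.trace_eq_one] at this
  simpa [prob] using this.symm

theorem IsDensityMatrix.prob_le_one (hR : IsDensityMatrix R) (i : Fin n) : hR.prob i ≤ 1 :=
  hR.sum_prob ▸ Finset.single_le_sum (fun j _ => hR.prob_nonneg j) (Finset.mem_univ i)

theorem IsDensityMatrix.pos (hR : IsDensityMatrix R) : 0 < n := by
  rcases Nat.eq_zero_or_pos n with rfl | h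
  · have := hR.sum_prob; simp at this
  · exact h

theorem IsDensityMatrix.sum_basis_sq (hR : IsDensityMatrix R) (i : Fin n) :
    ∑ j, (hR.basis i).ofLp j ^ 2 = 1 := by
  have h := hR.basis.norm_eq_one i
  rw [EuclideanSpace.norm_eq, Real.sqrt_eq_one] at h
  simpa using h

/-! ### The power method for a fixed starting vector -/

/-- The quotient is a weighted mean of the eigenvalues with weights `pᵢ ^ (2t) cᵢ²`; every later
bound on Rayleigh quotients is read off from this form. -/
theorem IsDensityMatrix.rayleigh_iterate (hR : IsDensityMatrix R) (t : ℕ) (x : Fin n → ℝ) :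
    rayleigh R ((fun v => R *ᵥ v)^[t] x)
      = (∑ i, hR.prob i * (hR.prob i ^ t * hR.coord x i) ^ 2)
        / ∑ i, (hR.prob i ^ t * hR.coord x i) ^ 2 := by
  rw [rayleigh, hR.dotProduct_eq_sum, hR.dotProduct_eq_sum]
  congr 1
  all_goals
    refine Finset.sum_congr rfl fun i _ => ?_
    simp only [hR.coord_mulVec, hR.coord_iterate]; ring

theorem IsDensityMatrix.rayleigh_nonneg (hR : IsDensityMatrix R) (t : ℕ) (x : Fin n → ℝ) :
    0 ≤ rayleigh R ((fun v => R *ᵥ v)^[t] x) := by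
  rw [hR.rayleigh_iterate]
  exact div_nonneg (Finset.sum_nonneg fun i _ => mul_nonneg (hR.prob_nonneg i) (sq_nonneg _))
    (Finset.sum_nonneg fun i _ => sq_nonneg _)

/-- A positive definite matrix never sends a nonzero vector to zero. Without this the Rayleigh
quotient could be `0 / 0 = 0`, and lower bounds on it would fail. -/
theorem IsDensityMatrix.sum_iterate_pos (hR : IsDensityMatrix R) (h : ∀ i, 0 < hR.prob i)
    (t : ℕ) {x : Fin n → ℝ} (hx : x ⬝ᵥ x ≠ 0) :
    0 < ∑ i, (hR.prob i ^ t * hR.coord x i) ^ 2 := by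
  rw [hR.dotProduct_eq_sum] at hx
  obtain ⟨i, _, hi⟩ := Finset.exists_ne_zero_of_sum_ne_zero hx
  have hi' : hR.coord x i ≠ 0 := fun h0 => hi (by simp [h0])
  refine Finset.sum_pos' (fun i _ => sq_nonneg _) ⟨i, Finset.mem_univ i, ?_⟩
  have := h i
  positivity

/-- A weighted mean of the eigenvalues is at least the smallest one. This holds for every nonzero
start, hence for unlucky sign draws too, which the running time bound requires. -/
theorem IsDensityMatrix.le_rayleigh (hR : IsDensityMatrix R) {ℓ : ℝ} (hℓ : 0 < ℓ)
    (h : ∀ i, ℓ ≤ hR.prob i) (t : ℕ) {x : Fin n → ℝ} (hx : x ⬝ᵥ x ≠ 0) :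
    ℓ ≤ rayleigh R ((fun v => R *ᵥ v)^[t] x) := by
  rw [hR.rayleigh_iterate,
    le_div_iff₀ (hR.sum_iterate_pos (fun i => hℓ.trans_le (h i)) t hx), Finset.mul_sum]
  exact Finset.sum_le_sum fun i _ => mul_le_mul_of_nonneg_right (h i) (sq_nonneg _)

/-- If the starting vector is not too orthogonal to an eigenvector, then the power method overtakes
its eigenvalue up to a factor of six. -/
theorem IsDensityMatrix.prob_le_rayleigh (hR : IsDensityMatrix R) (hp : ∀ i, 0 < hR.prob i)
    {i₀ : Fin n} {t : ℕ} (ht : 4 * (n : ℝ) ≤ Real.exp 1 ^ (2 * t)) {x : Fin n → ℝ} (hx : x ⬝ᵥ x = n)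
    (hx₀ : 1 / 4 ≤ hR.coord x i₀ ^ 2) :
    hR.prob i₀ ≤ 6 * rayleigh R ((fun v => R *ᵥ v)^[t] x) := by
  have hn : (0 : ℝ) < n := by exact_mod_cast hR.pos
  have hD := hR.sum_iterate_pos hp t (x := x) (by rw [hx]; exact hn.ne')
  -- Threshold between large and small eigenvalues: below `p / e`, each step shrinks a squared
  -- coordinate by a further factor `e²` relative to that of `i₀`, and `e ^ (2t) ≥ 4n` in total.
  set c : ℝ := hR.prob i₀ / Real.exp 1 with hc
  have hP := hp i₀
  have hc0 : 0 < c := by positivity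
  set f : Fin n → ℝ := fun i => (hR.prob i ^ t * hR.coord x i) ^ 2 with hf
  have hf0 : ∀ i, 0 ≤ f i := fun i => sq_nonneg _
  set S : Finset (Fin n) := Finset.univ.filter fun i => c ≤ hR.prob i with hS
  set T : Finset (Fin n) := Finset.univ.filter fun i => ¬ c ≤ hR.prob i with hT
  have hsplit : ∑ i, f i = ∑ i ∈ S, f i + ∑ i ∈ T, f i :=
    (Finset.sum_filter_add_sum_filter_not _ _ _).symm
  -- The squared coordinates of the start sum to `x ⬝ᵥ x = n`, so the small eigenvalues together
  -- carry at most this weight. The single index `i₀` already outweighs it.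
  have hsmall : ∑ i ∈ T, f i ≤ c ^ (2 * t) * n := by
    rw [← hx, hR.dotProduct_eq_sum, Finset.mul_sum]
    refine (Finset.sum_le_sum (g := fun i => c ^ (2 * t) * (hR.coord x i * hR.coord x i))
      fun i hi => ?_).trans
      (Finset.sum_le_sum_of_subset_of_nonneg (Finset.subset_univ _) fun i _ _ => ?_)
    · have : hR.prob i ^ (2 * t) ≤ c ^ (2 * t) :=
        pow_le_pow_left₀ (hp i).le (not_le.1 (Finset.mem_filter.1 hi).2).le _
      calc f i = hR.prob i ^ (2 * t) * (hR.coord x i * hR.coord x i) := by simp only [hf]; ring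
        _ ≤ _ := mul_le_mul_of_nonneg_right this (mul_self_nonneg _)
    · exact mul_nonneg (by positivity) (mul_self_nonneg _)
  have hi₀ : i₀ ∈ S := by
    simp only [hS, Finset.mem_filter, Finset.mem_univ, true_and, hc]
    exact div_le_self hP.le (Real.one_le_exp zero_le_one)
  have hbig : c ^ (2 * t) * n ≤ ∑ i ∈ S, f i := by
    refine le_trans ?_ (Finset.single_le_sum (fun i _ => hf0 i) hi₀)
    have h1 : c ^ (2 * t) * n ≤ hR.prob i₀ ^ (2 * t) * (1 / 4) := by
      rw [hc, div_pow, div_mul_eq_mul_div, div_le_iff₀ (by positivity)]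
      nlinarith [pow_pos hP (2 * t)]
    calc c ^ (2 * t) * n ≤ hR.prob i₀ ^ (2 * t) * (1 / 4) := h1
      _ ≤ hR.prob i₀ ^ (2 * t) * hR.coord x i₀ ^ 2 := by gcongr
      _ = f i₀ := by simp only [hf]; ring
  have hnum : c * ∑ i ∈ S, f i ≤ ∑ i, hR.prob i * f i := by
    rw [Finset.mul_sum]
    refine (Finset.sum_le_sum fun i hi => ?_).trans
      (Finset.sum_le_sum_of_subset_of_nonneg (Finset.subset_univ S) fun i _ _ => ?_)
    · exact mul_le_mul_of_nonneg_right (Finset.mem_filter.1 hi).2 (hf0 i)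
    · exact mul_nonneg (hp i).le (hf0 i)
  rw [hR.rayleigh_iterate, ← mul_div_assoc, le_div_iff₀ hD]
  -- The factor six is `3 * 2`: `p ≤ 3c` from `e ≤ 3`, and the total weight is at most twice the
  -- weight on `S`.
  have he : Real.exp 1 ≤ 3 := by linarith [Real.exp_one_lt_d9]
  have hce : hR.prob i₀ ≤ 3 * c := by
    have : hR.prob i₀ = Real.exp 1 * c := by rw [hc]; field_simp
    rw [this]; gcongr
  have hS0 : 0 ≤ ∑ i ∈ S, f i := Finset.sum_nonneg fun i _ => hf0 i
  calc hR.prob i₀ * ∑ i, f i ≤ (3 * c) * (2 * ∑ i ∈ S, f i) := by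
        gcongr
        linarith
    _ = 6 * (c * ∑ i ∈ S, f i) := by ring
    _ ≤ 6 * ∑ i, hR.prob i * f i := by gcongr

end Spectral

/-! ### Blocks of an i.i.d. sequence -/

/-- Cut the beginning of a sequence into `q` blocks of length `n`. -/
def blocks {X : Type*} (q n : ℕ) (ω : ℕ → X) (j : Fin q) (i : Fin n) : X := ω (j * n + i)

theorem measurable_blocks {X : Type*} [MeasurableSpace X] (q n : ℕ) :
    Measurable (blocks (X := X) q n) := by
  unfold blocks; fun_prop

theorem block_index_injective (q n : ℕ) :
    Function.Injective fun p : Fin q × Fin n => (p.1 : ℕ) * n + (p.2 : ℕ) := by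
  rintro ⟨j, i⟩ ⟨j', i'⟩ h
  have hn : 0 < n := i.pos
  have h : (j : ℕ) * n + i = j' * n + i' := h
  have h1 := congrArg (· / n) h
  have h2 := congrArg (· % n) h
  simp only [Nat.add_comm _ (i : ℕ), Nat.add_comm _ (i' : ℕ), Nat.add_mul_div_right _ _ hn,
    Nat.div_eq_of_lt i.2, Nat.div_eq_of_lt i'.2, Nat.add_mul_mod_self_right,
    Nat.mod_eq_of_lt i.2, Nat.mod_eq_of_lt i'.2] at h1 h2
  ext <;> simp <;> omega

/-- Distinct positions in the blocks use distinct entries of the sequence, so reindexing along this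
injection preserves independence; currying then turns a product over pairs into a product of
products. -/
theorem map_blocks_infinitePi {X : Type*} [MeasurableSpace X] (μ : Measure X)
    [IsProbabilityMeasure μ] (q n : ℕ) :
    (Measure.infinitePi fun _ : ℕ => μ).map (blocks q n)
      = Measure.pi fun _ : Fin q => Measure.pi fun _ : Fin n => μ := by
  have hind : iIndepFun (fun (k : ℕ) (ω : ℕ → X) => ω k) (Measure.infinitePi fun _ : ℕ => μ) := by
    rw [iIndepFun_iff_map_fun_eq_infinitePi_map (by fun_prop), Measure.map_id']
    congr
    funext i
    exact ((measurePreserving_eval_infinitePi (fun _ : ℕ => μ) i).map_eq).symm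
  have h1 := (hind.precomp (block_index_injective q n)).map_fun_eq_infinitePi_map (by fun_prop)
  have h2 : ∀ k : ℕ, (Measure.infinitePi fun _ : ℕ => μ).map (fun ω => ω k) = μ := fun k =>
    (measurePreserving_eval_infinitePi (fun _ : ℕ => μ) k).map_eq
  have h3 : blocks (X := X) q n = (MeasurableEquiv.curry (Fin q) (Fin n) X) ∘
      fun ω (p : Fin q × Fin n) => ω ((p.1 : ℕ) * n + (p.2 : ℕ)) := rfl
  rw [h3, ← Measure.map_map (by fun_prop) (by fun_prop)]
  refine (congrArg _ h1).trans ?_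
  simp only [h2]
  rw [Measure.infinitePi_map_curry (fun _ _ => μ)]
  simp only [Measure.infinitePi_eq_pi]

/-! ### Random signs -/

section Signs

variable {Ω ι : Type*} [MeasurableSpace Ω] {μ : Measure Ω} {X : ι → Ω → ℝ}

theorem integrable_of_measurable_of_bounded [IsFiniteMeasure μ] {f : Ω → ℝ} (hf : Measurable f)
    (b : ℝ) (hb : ∀ ω, |f ω| ≤ b) : Integrable f μ :=
  Integrable.of_bound hf.aestronglyMeasurable b (Filter.Eventually.of_forall hb)

/-- The second and fourth moments of a linear combination of independent signs. -/
theorem moments_sum_signs [IsProbabilityMeasure μ] (hind : iIndepFun X μ)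
    (hm : ∀ i, Measurable (X i)) (hsq : ∀ i ω, X i ω ^ 2 = 1) (hmean : ∀ i, ∫ ω, X i ω ∂μ = 0)
    (v : ι → ℝ) (s : Finset ι) :
    ∫ ω, (∑ i ∈ s, v i * X i ω) ^ 2 ∂μ = ∑ i ∈ s, v i ^ 2 ∧
    ∫ ω, (∑ i ∈ s, v i * X i ω) ^ 4 ∂μ ≤ 3 * (∑ i ∈ s, v i ^ 2) ^ 2 := by
  classical
  induction s using Finset.induction_on with
  | empty => simp
  | insert a s ha ih =>
    set f : Ω → ℝ := fun ω => ∑ i ∈ s, v i * X i ω with hf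
    have hfm : Measurable f := by fun_prop
    have habs : ∀ i ω, |X i ω| = 1 := fun i ω => by
      rw [← abs_one, ← sq_eq_sq_iff_abs_eq_abs, hsq]; norm_num
    have hfb : ∀ ω, |f ω| ≤ ∑ i ∈ s, |v i| := fun ω => by
      refine (Finset.abs_sum_le_sum_abs _ _).trans (Finset.sum_le_sum fun i _ => ?_)
      rw [abs_mul, habs, mul_one]
    set b := ∑ i ∈ s, |v i|
    have hint : ∀ k : ℕ, Integrable (fun ω => f ω ^ k) μ := fun k =>
      integrable_of_measurable_of_bounded (hfm.pow_const k) (b ^ k) fun ω => by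
        rw [abs_pow]; exact pow_le_pow_left₀ (abs_nonneg _) (hfb ω) k
    have hintX : ∀ k : ℕ, Integrable (fun ω => f ω ^ k * X a ω) μ := fun k =>
      integrable_of_measurable_of_bounded ((hfm.pow_const k).mul (hm a)) (b ^ k) fun ω => by
        rw [abs_mul, abs_pow, habs, mul_one]; exact pow_le_pow_left₀ (abs_nonneg _) (hfb ω) k
    -- Independence of a finite sum from a remaining member is applied to the rescaled family, whose
    -- scale at `a` is set to one so that this member is `X a` itself.
    have hI : IndepFun f (X a) μ := by
      have h1 : iIndepFun (fun i ω => (if i = a then 1 else v i) * X i ω) μ :=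
        hind.comp (fun i x => (if i = a then 1 else v i) * x) (by fun_prop)
      have h2 := h1.indepFun_finsetSum_of_notMem (by fun_prop) ha
      convert h2 using 1
      · ext ω
        simp only [hf, Finset.sum_apply]
        refine Finset.sum_congr rfl fun i hi => ?_
        rw [if_neg (by rintro rfl; exact ha hi)]
      · ext ω; simp
    have hzero : ∀ k : ℕ, ∫ ω, f ω ^ k * X a ω ∂μ = 0 := fun k => by
      have := (hI.comp (φ := fun x => x ^ k) (ψ := id) (by fun_prop)
        measurable_id).integral_fun_mul_eq_mul_integral
        (hfm.pow_const k).aestronglyMeasurable (hm a).aestronglyMeasurable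
      simp only [Function.comp_def, id] at this
      rw [this, hmean, mul_zero]
    -- Binomial expansions with `X a ^ 2 = 1`. The terms left with one factor `X a` integrate to
    -- zero by independence and centering.
    have e2 : ∀ ω, (∑ i ∈ insert a s, v i * X i ω) ^ 2
        = f ω ^ 2 + 2 * v a * (f ω ^ 1 * X a ω) + v a ^ 2 := fun ω => by
      rw [Finset.sum_insert ha]
      linear_combination (v a ^ 2) * hsq a ω
    have e4 : ∀ ω, (∑ i ∈ insert a s, v i * X i ω) ^ 4
        = f ω ^ 4 + 4 * v a * (f ω ^ 3 * X a ω) + 6 * v a ^ 2 * f ω ^ 2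
          + 4 * v a ^ 3 * (f ω ^ 1 * X a ω) + v a ^ 4 := fun ω => by
      rw [Finset.sum_insert ha]
      linear_combination (6 * v a ^ 2 * f ω ^ 2 + 4 * v a ^ 3 * f ω * X a ω
        + v a ^ 4 * (X a ω ^ 2 + 1)) * hsq a ω
    obtain ⟨ih2, ih4⟩ := ih
    have i2 : ∫ ω, (f ω ^ 2 + 2 * v a * (f ω ^ 1 * X a ω) + v a ^ 2) ∂μ
        = ∫ ω, f ω ^ 2 ∂μ + v a ^ 2 := by
      rw [integral_add ((hint 2).fun_add ((hintX 1).const_mul _)) (integrable_const _),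
        integral_add (hint 2) ((hintX 1).const_mul _), integral_const_mul, hzero]
      simp
    have i4 : ∫ ω, (f ω ^ 4 + 4 * v a * (f ω ^ 3 * X a ω) + 6 * v a ^ 2 * f ω ^ 2
          + 4 * v a ^ 3 * (f ω ^ 1 * X a ω) + v a ^ 4) ∂μ
        = ∫ ω, f ω ^ 4 ∂μ + 6 * v a ^ 2 * ∫ ω, f ω ^ 2 ∂μ + v a ^ 4 := by
      rw [integral_add ((((hint 4).fun_add ((hintX 3).const_mul _)).fun_add
          ((hint 2).const_mul _)).fun_add ((hintX 1).const_mul _)) (integrable_const _),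
        integral_add (((hint 4).fun_add ((hintX 3).const_mul _)).fun_add ((hint 2).const_mul _))
          ((hintX 1).const_mul _),
        integral_add ((hint 4).fun_add ((hintX 3).const_mul _)) ((hint 2).const_mul _),
        integral_add (hint 4) ((hintX 3).const_mul _)]
      simp only [integral_const_mul, hzero]
      simp
    simp only [e2, e4]
    rw [i2, i4, Finset.sum_insert ha, ih2]
    refine ⟨by ring, ?_⟩
    -- With `S` the old sum of squares, the new moment is at most `3S² + 6v²S + v⁴`, which falls
    -- short of `3(S + v²)²` by `2v⁴`.
    nlinarith [sq_nonneg (v a ^ 2)]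

/-- Anticoncentration of a linear combination of independent signs. -/
theorem measure_sum_signs_ge [IsProbabilityMeasure μ] [Fintype ι] (hind : iIndepFun X μ)
    (hm : ∀ i, Measurable (X i)) (hsq : ∀ i ω, X i ω ^ 2 = 1) (hmean : ∀ i, ∫ ω, X i ω ∂μ = 0)
    (v : ι → ℝ) (hv : ∑ i, v i ^ 2 = 1) :
    3 / 16 ≤ μ.real {ω | 1 / 4 ≤ (∑ i, v i * X i ω) ^ 2} := by
  obtain ⟨h2, h4⟩ := moments_sum_signs hind hm hsq hmean v Finset.univ
  rw [hv] at h2 h4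
  set f : Ω → ℝ := fun ω => ∑ i, v i * X i ω with hf
  have hfm : Measurable f := by fun_prop
  have habs : ∀ i ω, |X i ω| = 1 := fun i ω => by
    rw [← abs_one, ← sq_eq_sq_iff_abs_eq_abs, hsq]; norm_num
  have hfb : ∀ ω, |f ω| ≤ ∑ i, |v i| := fun ω => by
    refine (Finset.abs_sum_le_sum_abs _ _).trans (Finset.sum_le_sum fun i _ => ?_)
    rw [abs_mul, habs, mul_one]
  have hint : ∀ k : ℕ, Integrable (fun ω => f ω ^ k) μ := fun k =>
    integrable_of_measurable_of_bounded (hfm.pow_const k) ((∑ i, |v i|) ^ k) fun ω => by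
      rw [abs_pow]; exact pow_le_pow_left₀ (abs_nonneg _) (hfb ω) k
  have hS : MeasurableSet {ω | 1 / 4 ≤ f ω ^ 2} :=
    measurableSet_le measurable_const (hfm.pow_const 2)
  have hind1 : Integrable ({ω | 1 / 4 ≤ f ω ^ 2}.indicator fun _ => (1 : ℝ)) μ :=
    (integrable_const _).indicator hS
  -- Paley–Zygmund in linear form: `y - 1/4 ≤ y²/8 + 2 * 1_{y ≥ 1/4}` for `y = f²`, because `y²/8 -
  -- y + 2 = (y - 4)²/8`. Integrating gives `3/4 ≤ 3/8 + 2P`, that is `P ≥ 3/16`.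
  have hle : ∫ ω, (f ω ^ 2 - 1 / 4) ∂μ
      ≤ ∫ ω, (1 / 8 * f ω ^ 4 + 2 * {ω | 1 / 4 ≤ f ω ^ 2}.indicator (fun _ => (1 : ℝ)) ω) ∂μ := by
    refine integral_mono ((hint 2).sub (integrable_const _))
      (((hint 4).const_mul _).add (hind1.const_mul _)) fun ω => ?_
    by_cases h : 1 / 4 ≤ f ω ^ 2
    · rw [Set.indicator_of_mem (by exact h)]
      nlinarith [sq_nonneg (f ω ^ 2 - 4)]
    · rw [Set.indicator_of_notMem (by exact h)]
      nlinarith [sq_nonneg (f ω ^ 2)]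
  rw [integral_sub (hint 2) (integrable_const _),
    integral_add ((hint 4).const_mul _) (hind1.const_mul _), integral_const_mul,
    integral_const_mul, integral_indicator_const _ hS, h2] at hle
  simp only [integral_const, probReal_univ, smul_eq_mul, mul_one] at hle
  linarith

end Signs

/-- The law of a fair coin. -/
abbrev coin : Measure Bool := uniformOn Set.univ

instance : IsProbabilityMeasure coin :=
  isProbabilityMeasure_uniformOn Set.finite_univ Set.univ_nonempty

theorem signOf_sq (b : Bool) : signOf b ^ 2 = 1 := by cases b <;> simp [signOf]

theorem integral_signOf_coin : ∫ b, signOf b ∂coin = 0 := by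
  have h : ∀ b : Bool, coin.real {b} = 1 / 2 := fun b => by
    rw [Measure.real, uniformOn_univ]; simp
  rw [integral_fintype (Integrable.of_finite)]
  simp [h, signOf]

theorem measure_sum_signOf_ge {n : ℕ} {μ : Measure Bool} [IsProbabilityMeasure μ]
    (hμ : ∫ b, signOf b ∂μ = 0) (v : Fin n → ℝ) (hv : ∑ i, v i ^ 2 = 1) :
    3 / 16 ≤ (Measure.pi fun _ : Fin n => μ).real
      {x | 1 / 4 ≤ (∑ i, v i * signOf (x i)) ^ 2} := by
  have hs : Measurable signOf := measurable_of_countable _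
  have hind : iIndepFun (fun (i : Fin n) (x : Fin n → Bool) => signOf (x i))
      (Measure.pi fun _ : Fin n => μ) :=
    iIndepFun_pi (X := fun _ => signOf) fun _ => hs.aemeasurable
  have hmean : ∀ i : Fin n, ∫ x : Fin n → Bool, signOf (x i) ∂(Measure.pi fun _ => μ) = 0 := by
    intro i
    rw [integral_comp_eval (μ := fun _ : Fin n => μ) (f := signOf) hs.aestronglyMeasurable, hμ]
  exact measure_sum_signs_ge hind (fun i => hs.comp (measurable_pi_apply i))
    (fun i x => signOf_sq _) hmean v hv

/-- Here `13/16 = 1 - 3/16` is the failure probability allowed to one start, and `4.82` is just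
above `1 / ln (16/13)`. The numerical fact `e ^ (1/4.82) ≤ 16/13` follows from a cubic Taylor bound
with remainder. -/
theorem pow_powerReps_le {δ : ℝ} (h0 : 0 < δ) : (13 / 16 : ℝ) ^ powerReps δ ≤ δ := by
  have h1 : (13 / 16 : ℝ) ≤ Real.exp (-(1 / 4.82)) := by
    rw [Real.exp_neg, show (13 / 16 : ℝ) = (16 / 13)⁻¹ by norm_num]
    refine inv_anti₀ (Real.exp_pos _) ?_
    refine (Real.exp_bound' (x := 1 / 4.82) (by norm_num) (by norm_num)
      (n := 4) (by norm_num)).trans ?_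
    norm_num [Finset.sum_range_succ, Nat.factorial]
  calc (13 / 16 : ℝ) ^ powerReps δ ≤ Real.exp (-(1 / 4.82)) ^ powerReps δ :=
        pow_le_pow_left₀ (by norm_num) h1 _
    _ = Real.exp (powerReps δ * (-(1 / 4.82))) := (Real.exp_nat_mul _ _).symm
    _ ≤ Real.exp (Real.log δ) := by
        have : (4.82 : ℝ) * Real.log (1 / δ) ≤ powerReps δ := Nat.le_ceil _
        rw [Real.exp_le_exp]
        rw [one_div, Real.log_inv] at this
        norm_num at this ⊢
        linarith
    _ = δ := Real.exp_log h0

/-- Among sufficiently many independent random sign vectors, one has a large inner product with a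
given unit vector, with high probability. -/
theorem measure_exists_signs_ge {n : ℕ} (v : Fin n → ℝ) (hv : ∑ i, v i ^ 2 = 1) {δ : ℝ}
    (h0 : 0 < δ) :
    1 - δ ≤ (Measure.pi fun _ : Fin (powerReps δ) => Measure.pi fun _ : Fin n => coin).real
      {x | ∃ j, 1 / 4 ≤ (∑ i, v i * signOf (x j i)) ^ 2} := by
  set S : Set (Fin n → Bool) := {x | 1 / 4 ≤ (∑ i, v i * signOf (x i)) ^ 2} with hS
  have hSm : MeasurableSet S := S.to_countable.measurableSet
  -- Failure means that every start fails: a product set, whose measure is the power of the single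
  -- failure probability.
  have hcompl : {x : Fin (powerReps δ) → Fin n → Bool |
      ∃ j, 1 / 4 ≤ (∑ i, v i * signOf (x j i)) ^ 2}ᶜ = Set.univ.pi fun _ => Sᶜ := by
    ext x; simp [hS, Set.mem_pi]
  have hm : MeasurableSet {x : Fin (powerReps δ) → Fin n → Bool |
      ∃ j, 1 / 4 ≤ (∑ i, v i * signOf (x j i)) ^ 2} := (Set.to_countable _).measurableSet
  have hfail : (Measure.pi fun _ : Fin (powerReps δ) => Measure.pi fun _ : Fin n => coin).real
      (Set.univ.pi fun _ => Sᶜ) ≤ δ := by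
    rw [Measure.real, Measure.pi_pi, ENNReal.toReal_prod]
    refine le_trans ?_ (pow_powerReps_le h0)
    rw [Finset.prod_const, Finset.card_univ, Fintype.card_fin]
    refine pow_le_pow_left₀ ENNReal.toReal_nonneg ?_ _
    have := probReal_compl_eq_one_sub (μ := Measure.pi fun _ : Fin n => coin) hSm
    rw [← Measure.real, this]
    linarith [measure_sum_signOf_ge integral_signOf_coin v hv]
  have := probReal_compl_eq_one_sub
    (μ := Measure.pi fun _ : Fin (powerReps δ) => Measure.pi fun _ : Fin n => coin) hm
  rw [hcompl] at this
  linarith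

/-! ### Concentration of Gaussian quadratic forms -/

theorem integral_exp_mul_sq_gaussianReal {θ : ℝ} (hθ : θ < 1 / 2) :
    ∫ z, Real.exp (θ * z ^ 2) ∂(gaussianReal 0 1) = (√(1 - 2 * θ))⁻¹ := by
  rw [integral_gaussianReal_eq_integral_smul one_ne_zero]
  have h : ∀ z : ℝ, gaussianPDFReal 0 1 z • Real.exp (θ * z ^ 2)
      = (√(2 * Real.pi))⁻¹ * Real.exp (-(1 / 2 - θ) * z ^ 2) := fun z => by
    rw [gaussianPDFReal, smul_eq_mul, mul_assoc, ← Real.exp_add]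
    simp only [NNReal.coe_one, mul_one, sub_zero]
    congr 2
    ring
  simp only [h]
  rw [integral_const_mul, integral_gaussian, ← Real.sqrt_inv, ← Real.sqrt_mul (by positivity),
    ← Real.sqrt_inv]
  congr 1
  have : 0 < 1 / 2 - θ := by linarith
  have : 0 < 1 - 2 * θ := by linarith
  field_simp

/-- In logarithms, `-ln (1 - 2θ) / 2 ≤ θ + 4θ²` follows from `ln y ≥ 1 - y⁻¹`; the remaining
difference has the sign of `1 - 4θ`. No lower bound on `θ` is needed, so both tails are covered. -/
theorem inv_sqrt_one_sub_le {θ : ℝ} (hθ : θ ≤ 1 / 4) :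
    (√(1 - 2 * θ))⁻¹ ≤ Real.exp (θ + 4 * θ ^ 2) := by
  have hpos : 0 < 1 - 2 * θ := by linarith
  have hlog : -(2 * θ) - 2 * (2 * θ) ^ 2 ≤ Real.log (1 - 2 * θ) := by
    refine le_trans ?_ (Real.one_sub_inv_le_log_of_pos hpos)
    have : 1 - (1 - 2 * θ)⁻¹ - (-(2 * θ) - 2 * (2 * θ) ^ 2)
        = (2 * θ) ^ 2 * (1 - 4 * θ) / (1 - 2 * θ) := by field_simp; ring
    have h2 : 0 ≤ (2 * θ) ^ 2 * (1 - 4 * θ) / (1 - 2 * θ) :=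
      div_nonneg (mul_nonneg (sq_nonneg _) (by linarith)) hpos.le
    linarith
  rw [← Real.exp_log (inv_pos.2 (Real.sqrt_pos.2 hpos)), Real.exp_le_exp, Real.log_inv,
    Real.log_sqrt hpos.le]
  linarith

/-- The law of `s` independent standard Gaussian vectors of length `n`. -/
abbrev gaussianVectors (s n : ℕ) : Measure (Fin s → Fin n → ℝ) :=
  Measure.pi fun _ => Measure.pi fun _ => gaussianReal 0 1

theorem integral_exp_quadForm {s n : ℕ} (a : Fin n → ℝ) {θ : ℝ} (hθ : ∀ i, θ * a i < 1 / 2) :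
    ∫ g, Real.exp (θ * ∑ j, ∑ i, a i * g j i ^ 2) ∂(gaussianVectors s n)
      = (∏ i, (√(1 - 2 * (θ * a i)))⁻¹) ^ s := by
  have h1 : ∀ g : Fin s → Fin n → ℝ, Real.exp (θ * ∑ j, ∑ i, a i * g j i ^ 2)
      = ∏ j, ∏ i, Real.exp (θ * a i * g j i ^ 2) := fun g => by
    rw [Finset.mul_sum, Real.exp_sum]
    refine Finset.prod_congr rfl fun j _ => ?_
    rw [Finset.mul_sum, Real.exp_sum]
    exact Finset.prod_congr rfl fun i _ => by rw [mul_assoc]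
  simp only [h1]
  rw [integral_fintype_prod_eq_pow (fun z : Fin n → ℝ => ∏ i, Real.exp (θ * a i * z i ^ 2)),
    integral_fintype_prod_eq_prod (fun i z => Real.exp (θ * a i * z ^ 2)), Fintype.card_fin]
  congr 1
  exact Finset.prod_congr rfl fun i _ => integral_exp_mul_sq_gaussianReal (hθ i)

/-- Weights in `[0, 1]` satisfy `aᵢ² ≤ aᵢ`, so with total weight one the product of the factors is
bounded independently of the weights and of the dimension. -/
theorem mgf_quadForm_le {s n : ℕ} {a : Fin n → ℝ} (ha : ∀ i, 0 ≤ a i) (hsum : ∑ i, a i = 1)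
    {θ : ℝ} (hθ : |θ| ≤ 1 / 4) :
    Integrable (fun g => Real.exp (θ * ∑ j, ∑ i, a i * g j i ^ 2)) (gaussianVectors s n) ∧
    mgf (fun g => ∑ j, ∑ i, a i * g j i ^ 2) (gaussianVectors s n) θ
      ≤ Real.exp (s * (θ + 4 * θ ^ 2)) := by
  have ha1 : ∀ i, a i ≤ 1 := fun i =>
    hsum ▸ Finset.single_le_sum (fun j _ => ha j) (Finset.mem_univ i)
  have hθa : ∀ i, θ * a i ≤ 1 / 4 := fun i => by
    calc θ * a i ≤ |θ| * 1 := mul_le_mul (le_abs_self θ) (ha1 i) (ha i) (abs_nonneg _)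
      _ ≤ 1 / 4 := by linarith
  have hI := integral_exp_quadForm (s := s) a (θ := θ) fun i => (hθa i).trans_lt (by norm_num)
  have hfac : ∀ i, 0 < (√(1 - 2 * (θ * a i)))⁻¹ := fun i =>
    inv_pos.2 (Real.sqrt_pos.2 (by linarith [hθa i]))
  -- A nonintegrable function has Bochner integral zero by convention, so the nonzero value just
  -- computed proves integrability.
  refine ⟨Integrable.of_integral_ne_zero ?_, ?_⟩
  · rw [hI]; exact (pow_pos (Finset.prod_pos fun i _ => hfac i) _).ne'
  · rw [mgf, hI, Real.exp_nat_mul]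
    refine pow_le_pow_left₀ (Finset.prod_nonneg fun i _ => (hfac i).le) ?_ _
    calc ∏ i, (√(1 - 2 * (θ * a i)))⁻¹ ≤ ∏ i, Real.exp (θ * a i + 4 * (θ * a i) ^ 2) :=
          Finset.prod_le_prod (fun i _ => (hfac i).le) fun i _ => inv_sqrt_one_sub_le (hθa i)
      _ = Real.exp (∑ i, (θ * a i + 4 * (θ * a i) ^ 2)) := (Real.exp_sum _ _).symm
      _ ≤ Real.exp (∑ i, (θ * a i + 4 * θ ^ 2 * a i)) := by
          refine Real.exp_le_exp.2 (Finset.sum_le_sum fun i _ => ?_)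
          have : a i ^ 2 ≤ a i := by nlinarith [ha i, ha1 i]
          nlinarith [mul_le_mul_of_nonneg_left this (sq_nonneg θ)]
      _ = Real.exp (θ + 4 * θ ^ 2) := by
          rw [Finset.sum_add_distrib, ← Finset.mul_sum, ← Finset.mul_sum, hsum, mul_one, mul_one]

/-- The Chernoff exponent below is `s ε² / 16`, so the constant `16` would suffice in place of `20`.
-/
theorem exp_numGaussians_le {ε δ : ℝ} (hε : 0 < ε) (hδ : 0 < δ) (hδ2 : δ < 1) :
    Real.exp (-(numGaussians ε δ * ε ^ 2 / 16)) ≤ δ / 2 := by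
  have h1 : 20 * Real.log (2 / δ) / ε ^ 2 ≤ numGaussians ε δ := Nat.le_ceil _
  rw [div_le_iff₀ (by positivity)] at h1
  have h2 : 0 ≤ Real.log (2 / δ) := Real.log_nonneg (by rw [le_div_iff₀ hδ]; linarith)
  calc Real.exp (-(numGaussians ε δ * ε ^ 2 / 16)) ≤ Real.exp (-Real.log (2 / δ)) :=
        Real.exp_le_exp.2 (by linarith)
    _ = δ / 2 := by rw [Real.exp_neg, Real.exp_log (by positivity), inv_div]

theorem numGaussians_pos {ε δ : ℝ} (hε : 0 < ε) (hδ : 0 < δ) (hδ2 : δ < 1) :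
    0 < numGaussians ε δ := by
  have : 0 < Real.log (2 / δ) := Real.log_pos (by rw [lt_div_iff₀ hδ]; linarith)
  exact Nat.ceil_pos.2 (by positivity)

theorem measurable_quadForm {s n : ℕ} (a : Fin n → ℝ) :
    Measurable fun g : Fin s → Fin n → ℝ => ∑ j, ∑ i, a i * g j i ^ 2 := by fun_prop

/-- Concentration of the empirical mean of a positive diagonal Gaussian quadratic form of trace
one. -/
theorem measure_quadForm_le_of_sum_one {n : ℕ} {a : Fin n → ℝ} (ha : ∀ i, 0 ≤ a i)
    (hsum : ∑ i, a i = 1) {ε δ : ℝ} (hε : 0 < ε) (hε1 : ε < 1) (hδ : 0 < δ) (hδ1 : δ < 1) :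
    1 - δ ≤ (gaussianVectors (numGaussians ε δ) n).real
      {g | |1 / (numGaussians ε δ : ℝ) * ∑ j, ∑ i, a i * g j i ^ 2 - 1| ≤ ε} := by
  set s := numGaussians ε δ with hs
  have hs0 : (0 : ℝ) < s := by exact_mod_cast numGaussians_pos hε hδ hδ1
  set Q : (Fin s → Fin n → ℝ) → ℝ := fun g => ∑ j, ∑ i, a i * g j i ^ 2 with hQ
  have hQm : Measurable Q := measurable_quadForm a
  set μ := gaussianVectors s n
  -- The choice `θ = ±ε/8` minimizes `-|θ| ε + 4θ²`, with value `-ε²/16`.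
  have habs : |ε / 8| ≤ 1 / 4 := by rw [abs_of_pos (by positivity)]; linarith
  have habs' : |-(ε / 8)| ≤ 1 / 4 := by rwa [abs_neg]
  obtain ⟨hi1, hm1⟩ := mgf_quadForm_le (s := s) ha hsum habs
  obtain ⟨hi2, hm2⟩ := mgf_quadForm_le (s := s) ha hsum habs'
  have hup : μ.real {g | s * (1 + ε) ≤ Q g} ≤ δ / 2 := by
    refine (measure_ge_le_exp_mul_mgf _ (by positivity : 0 ≤ ε / 8) hi1).trans ?_
    refine (mul_le_mul_of_nonneg_left hm1 (Real.exp_pos _).le).trans ?_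
    rw [← Real.exp_add]
    refine le_trans (Real.exp_le_exp.2 (le_of_eq ?_)) (exp_numGaussians_le hε hδ hδ1)
    rw [← hs]; ring
  have hlow : μ.real {g | Q g ≤ s * (1 - ε)} ≤ δ / 2 := by
    refine (measure_le_le_exp_mul_mgf _ (by linarith : -(ε / 8) ≤ 0) hi2).trans ?_
    refine (mul_le_mul_of_nonneg_left hm2 (Real.exp_pos _).le).trans ?_
    rw [← Real.exp_add]
    refine le_trans (Real.exp_le_exp.2 (le_of_eq ?_)) (exp_numGaussians_le hε hδ hδ1)
    rw [← hs]; ring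
  have hgood : MeasurableSet {g | |1 / (s : ℝ) * Q g - 1| ≤ ε} :=
    measurableSet_le (by fun_prop) measurable_const
  have hsub : {g | |1 / (s : ℝ) * Q g - 1| ≤ ε}ᶜ
      ⊆ {g | s * (1 + ε) ≤ Q g} ∪ {g | Q g ≤ s * (1 - ε)} := by
    intro g hg
    simp only [Set.mem_compl_iff, Set.mem_ofPred_eq, not_le, lt_abs, one_div] at hg
    have hQs : Q g = s * ((s : ℝ)⁻¹ * Q g) := by field_simp
    rcases hg with h | h
    · left
      show s * (1 + ε) ≤ Q g
      rw [hQs]; gcongr; linarith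
    · right
      show Q g ≤ s * (1 - ε)
      rw [hQs]; gcongr; linarith
  have hbad := (measureReal_mono hsub (μ := μ)).trans (measureReal_union_le _ _)
  rw [probReal_compl_eq_one_sub hgood] at hbad
  linarith

/-- Concentration of the empirical mean of a positive diagonal Gaussian quadratic form. -/
theorem measure_quadForm_le {n : ℕ} {a : Fin n → ℝ} (ha : ∀ i, 0 ≤ a i)
    {ε δ : ℝ} (hε : 0 < ε) (hε1 : ε < 1) (hδ : 0 < δ) (hδ1 : δ < 1) :
    1 - δ ≤ (gaussianVectors (numGaussians ε δ) n).real
      {g | |1 / (numGaussians ε δ : ℝ) * ∑ j, ∑ i, a i * g j i ^ 2 - ∑ i, a i|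
        ≤ ε * ∑ i, a i} := by
  -- Normalizing by the sum is impossible when it vanishes, but then all weights are zero and there
  -- is no error. In the application this happens for `n = 1`, where the entropy is zero.
  rcases (Finset.sum_nonneg fun i (_ : i ∈ Finset.univ) => ha i).eq_or_lt with h | h
  · have h0 : ∀ i, a i = 0 := fun i =>
      (Finset.sum_eq_zero_iff_of_nonneg fun i _ => ha i).1 h.symm i (Finset.mem_univ i)
    simp [h0, hδ.le]
  · refine (measure_quadForm_le_of_sum_one (a := fun i => a i / ∑ i, a i)
      (fun i => div_nonneg (ha i) h.le) (by rw [← Finset.sum_div, div_self h.ne'])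
      hε hε1 hδ hδ1).trans (measureReal_mono fun g hg => ?_)
    simp only [Set.mem_ofPred_eq] at hg ⊢
    have : ∑ j, ∑ i, a i / (∑ i, a i) * g j i ^ 2
        = (∑ j, ∑ i, a i * g j i ^ 2) / ∑ i, a i := by
      simp only [Finset.sum_div, div_mul_eq_mul_div]
    rw [this] at hg
    have e : 1 / (numGaussians ε δ : ℝ) * ∑ j, ∑ i, a i * g j i ^ 2 - ∑ i, a i
        = (1 / (numGaussians ε δ : ℝ) * ((∑ j, ∑ i, a i * g j i ^ 2) / ∑ i, a i) - 1)
          * ∑ i, a i := by field_simp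
    rw [e, abs_mul, abs_of_pos h]
    exact mul_le_mul_of_nonneg_right hg h.le

/-- The standard Gaussian law is invariant under a change of orthonormal basis. -/
theorem map_dotProduct_basis_pi_gaussian {n : ℕ}
    (b : OrthonormalBasis (Fin n) ℝ (EuclideanSpace ℝ (Fin n))) :
    (Measure.pi fun _ : Fin n => gaussianReal 0 1).map (fun z i => (b i).ofLp ⬝ᵥ z)
      = Measure.pi fun _ : Fin n => gaussianReal 0 1 := by
  have h : (fun (z : Fin n → ℝ) i => (b i).ofLp ⬝ᵥ z)
      = (WithLp.ofLp ∘ b.repr) ∘ WithLp.toLp 2 := by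
    ext z i
    simp [b.repr_apply_apply, EuclideanSpace.inner_eq_star_dotProduct, dotProduct_comm]
  have hof : Measurable (WithLp.ofLp : EuclideanSpace ℝ (Fin n) → Fin n → ℝ) := by fun_prop
  have hto : Measurable (WithLp.toLp 2 : (Fin n → ℝ) → EuclideanSpace ℝ (Fin n)) := by fun_prop
  have hb : Measurable b.repr := b.repr.continuous.measurable
  rw [h, ← Measure.map_map (hof.comp hb) hto, map_pi_eq_stdGaussian, ← Measure.map_map hof hb,
    stdGaussian_map, ← map_pi_eq_stdGaussian, Measure.map_map hof hto]
  exact Measure.map_id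

/-- Rotation invariance allows the quadratic forms to be treated as diagonal, with the eigenvalues
as weights. -/
theorem map_coord_gaussianVectors {n : ℕ} {R : Matrix (Fin n) (Fin n) ℝ} (hR : IsDensityMatrix R)
    (s : ℕ) : (gaussianVectors s n).map (fun g j => hR.coord (g j)) = gaussianVectors s n := by
  have hm : Measurable fun (z : Fin n → ℝ) i => (hR.basis i).ofLp ⬝ᵥ z := by
    simp only [dotProduct]; fun_prop
  have h := map_dotProduct_basis_pi_gaussian hR.basis
  have : IsProbabilityMeasure ((Measure.pi fun _ : Fin n => gaussianReal 0 1).map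
      (fun z i => (hR.basis i).ofLp ⬝ᵥ z)) := by rw [h]; infer_instance
  have h2 := Measure.pi_map_pi (μ := fun _ : Fin s => Measure.pi fun _ : Fin n => gaussianReal 0 1)
    (f := fun _ z i => (hR.basis i).ofLp ⬝ᵥ z) fun _ => hm.aemeasurable
  simp only [h] at h2
  exact h2

/-! ### The truncated Taylor expansion of the entropy -/

/-- The truncation of the power series of `-log (1 - x)`. -/
def logPartial (x : ℝ) (m : ℕ) : ℝ := ∑ k ∈ Finset.Icc 1 m, x ^ k / k

theorem logPartial_nonneg {x : ℝ} (hx : 0 ≤ x) (m : ℕ) : 0 ≤ logPartial x m :=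
  Finset.sum_nonneg fun k _ => by positivity

theorem logPartial_eq_range (x : ℝ) (m : ℕ) :
    logPartial x m = ∑ k ∈ Finset.range m, x ^ (k + 1) / ((k : ℝ) + 1) := by
  rw [logPartial, Finset.range_eq_Ico, ← Finset.sum_Ico_add_right_sub_eq (c := 1)]
  rw [show Finset.Icc 1 m = Finset.Ico (0 + 1) (m + 1) by ext; simp]
  refine Finset.sum_congr rfl fun k hk => ?_
  have hk : 1 ≤ k := by simpa using (Finset.mem_Ico.1 hk).1
  rw [Nat.sub_add_cancel hk, Nat.cast_sub hk]
  simp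

theorem logPartial_le {x : ℝ} (hx : 0 ≤ x) (hx1 : x < 1) (m : ℕ) :
    logPartial x m ≤ -Real.log (1 - x) := by
  rw [logPartial_eq_range]
  exact sum_le_hasSum _ (fun k _ => by positivity)
    (Real.hasSum_pow_div_log_of_abs_lt_one (by rwa [abs_of_nonneg hx]))

/-- Each tail term is dominated by a term of the full series: `x^(k+m+1)/(k+m+1) ≤ x^m *
x^(k+1)/(k+1)`. Measuring the tail against the whole logarithm is what makes the final error
multiplicative. -/
theorem neg_log_sub_logPartial_le {x : ℝ} (hx : 0 ≤ x) (hx1 : x < 1) (m : ℕ) :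
    -Real.log (1 - x) - logPartial x m ≤ x ^ m * -Real.log (1 - x) := by
  have h := Real.hasSum_pow_div_log_of_abs_lt_one (x := x) (by rwa [abs_of_nonneg hx])
  have h1 := (hasSum_nat_add_iff' m).2 h
  rw [← logPartial_eq_range] at h1
  refine hasSum_le (fun k => ?_) h1 (h.mul_left (x ^ m))
  have e : x ^ m * (x ^ (k + 1) / ((k : ℝ) + 1)) = x ^ (k + m + 1) / ((k : ℝ) + 1) := by ring
  rw [e]
  push_cast
  gcongr
  simp

section Entropy

variable {n : ℕ} {R : Matrix (Fin n) (Fin n) ℝ}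

/-- The `i`-th eigenvalue of the truncated Taylor series. -/
def IsDensityMatrix.taylorEigenvalue (hR : IsDensityMatrix R) (u : ℝ) (m : ℕ) (i : Fin n) : ℝ :=
  hR.prob i * logPartial (1 - u⁻¹ * hR.prob i) m

theorem IsDensityMatrix.taylorSum_eq (hR : IsDensityMatrix R) (u : ℝ) (m s : ℕ)
    (g : Fin s → Fin n → ℝ) : taylorSum R u m s g = Real.log u⁻¹ +
      1 / (s : ℝ) * ∑ j, ∑ i, hR.taylorEigenvalue u m i * hR.coord (g j) i ^ 2 := by
  rw [taylorSum]
  congr 2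
  refine Finset.sum_congr rfl fun j _ => ?_
  simp only [hR.quadForm_eq_sum, taylorEigenvalue, logPartial, Finset.mul_sum, Finset.sum_mul,
    Finset.sum_div]
  rw [Finset.sum_comm]
  exact Finset.sum_congr rfl fun i _ => Finset.sum_congr rfl fun k _ => by ring

/-- From `1 - p/u ≤ 1 - ℓ/u ≤ exp (-ℓ/u)`, and `m ℓ/u ≥ ln (1/ε)` by the choice of `m`. -/
theorem one_sub_pow_numTerms_le {p u ℓ ε : ℝ} (hℓ : 0 < ℓ) (hp : ℓ ≤ p) (hu : p ≤ u)
    (hε : 0 < ε) : (1 - u⁻¹ * p) ^ numTerms u ℓ ε ≤ ε := by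
  have hu0 : 0 < u := by linarith
  have hx : 0 ≤ 1 - u⁻¹ * p := by
    rw [sub_nonneg, inv_mul_le_iff₀ hu0]; linarith
  have hm : u / ℓ * Real.log (1 / ε) ≤ numTerms u ℓ ε := Nat.le_ceil _
  calc (1 - u⁻¹ * p) ^ numTerms u ℓ ε ≤ Real.exp (-(u⁻¹ * ℓ)) ^ numTerms u ℓ ε := by
        refine pow_le_pow_left₀ hx ?_ _
        have h1 := Real.add_one_le_exp (-(u⁻¹ * ℓ))
        have h2 : u⁻¹ * ℓ ≤ u⁻¹ * p := by gcongr
        linarith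
    _ = Real.exp (numTerms u ℓ ε * (-(u⁻¹ * ℓ))) := (Real.exp_nat_mul _ _).symm
    _ ≤ Real.exp (Real.log ε) := by
        rw [Real.exp_le_exp]
        have h3 : u / ℓ * Real.log (1 / ε) * (u⁻¹ * ℓ) ≤ numTerms u ℓ ε * (u⁻¹ * ℓ) := by gcongr
        have h4 : u / ℓ * Real.log (1 / ε) * (u⁻¹ * ℓ) = -Real.log ε := by
          rw [one_div, Real.log_inv]; field_simp
        linarith
    _ = ε := Real.exp_log hε

/-- Because `ln u⁻¹ ≥ 0`, an error relative to `H - ln u⁻¹` is also one relative to `H`. The second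
claim serves the same purpose for the Gaussian error, which is relative to the trace of the
truncated series. -/
theorem IsDensityMatrix.taylorEigenvalue_bounds (hR : IsDensityMatrix R) {u ℓ ε : ℝ}
    (hℓ : 0 < ℓ) (hp : ∀ i, ℓ ≤ hR.prob i) (hu : ∀ i, hR.prob i ≤ u) (hu1 : u ≤ 1) (hε : 0 < ε) :
    (∀ i, 0 ≤ hR.taylorEigenvalue u (numTerms u ℓ ε) i) ∧
    ∑ i, hR.taylorEigenvalue u (numTerms u ℓ ε) i ≤ hR.entropy ∧
    |Real.log u⁻¹ + ∑ i, hR.taylorEigenvalue u (numTerms u ℓ ε) i - hR.entropy|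
      ≤ ε * hR.entropy := by
  set m := numTerms u ℓ ε with hm
  have hp0 : ∀ i, 0 < hR.prob i := fun i => hℓ.trans_le (hp i)
  have hu0 : 0 < u := (hp0 ⟨0, hR.pos⟩).trans_le (hu _)
  have hx0 : ∀ i, 0 ≤ 1 - u⁻¹ * hR.prob i := fun i => by
    rw [sub_nonneg, inv_mul_le_iff₀ hu0]; linarith [hu i]
  have hx1 : ∀ i, 1 - u⁻¹ * hR.prob i < 1 := fun i => by
    have := mul_pos (inv_pos.2 hu0) (hp0 i); linarith
  set L : Fin n → ℝ := fun i => -Real.log (1 - (1 - u⁻¹ * hR.prob i)) with hL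
  -- The shift by `ln u⁻¹` comes out of the sum unweighted since the eigenvalues sum to one.
  have hLe : ∑ i, hR.prob i * L i = hR.entropy - Real.log u⁻¹ := by
    have : ∀ i, hR.prob i * L i
        = -(hR.prob i * Real.log (hR.prob i)) - hR.prob i * Real.log u⁻¹ := fun i => by
      simp only [hL, sub_sub_cancel]
      rw [Real.log_mul (inv_pos.2 hu0).ne' (hp0 i).ne']; ring
    simp only [this]
    rw [Finset.sum_sub_distrib, ← Finset.sum_mul, hR.sum_prob, one_mul, entropy,
      Finset.sum_neg_distrib]
  have hlog : 0 ≤ Real.log u⁻¹ := Real.log_nonneg ((one_le_inv₀ hu0).2 hu1)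
  have hle : ∑ i, hR.taylorEigenvalue u m i ≤ ∑ i, hR.prob i * L i :=
    Finset.sum_le_sum fun i _ =>
      mul_le_mul_of_nonneg_left (logPartial_le (hx0 i) (hx1 i) m) (hp0 i).le
  have htail : ∑ i, hR.prob i * L i - ∑ i, hR.taylorEigenvalue u m i
      ≤ ε * ∑ i, hR.prob i * L i := by
    rw [← Finset.sum_sub_distrib, Finset.mul_sum]
    refine Finset.sum_le_sum fun i _ => ?_
    have hL0 : 0 ≤ L i := (logPartial_nonneg (hx0 i) m).trans (logPartial_le (hx0 i) (hx1 i) m)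
    have h1 : L i - logPartial (1 - u⁻¹ * hR.prob i) m ≤ ε * L i :=
      (neg_log_sub_logPartial_le (hx0 i) (hx1 i) m).trans
        (mul_le_mul_of_nonneg_right (one_sub_pow_numTerms_le hℓ (hp i) (hu i) hε) hL0)
    calc hR.prob i * L i - hR.taylorEigenvalue u m i
        = hR.prob i * (L i - logPartial (1 - u⁻¹ * hR.prob i) m) := by
          rw [taylorEigenvalue]; ring
      _ ≤ hR.prob i * (ε * L i) := mul_le_mul_of_nonneg_left h1 (hp0 i).le
      _ = ε * (hR.prob i * L i) := by ring
  refine ⟨fun i => mul_nonneg (hp0 i).le (logPartial_nonneg (hx0 i) m), by linarith, ?_⟩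
  rw [abs_le]
  constructor
  · nlinarith
  · nlinarith

/-! ### Accuracy of the estimator -/

theorem four_mul_le_exp_powerSteps (hn : 0 < n) :
    4 * (n : ℝ) ≤ Real.exp 1 ^ (2 * powerSteps n) := by
  have h4 : (0 : ℝ) < 4 * n := by positivity
  have h' : Real.log (4 * n) / 2 ≤ powerSteps n := by
    rw [powerSteps, Real.log_sqrt h4.le]; exact Nat.le_ceil _
  rw [← Real.exp_nat_mul, mul_one, ← Real.log_le_iff_le_exp h4]
  push_cast
  linarith

theorem rayleigh_le_powerEstimate {q t : ℕ} (x : Fin q → Fin n → ℝ) (j : Fin q) :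
    rayleigh R ((fun v => R *ᵥ v)^[t] (x j)) ≤ powerEstimate R q t x :=
  le_ciSup (f := fun j => rayleigh R ((fun v => R *ᵥ v)^[t] (x j)))
    (Set.finite_range _).bddAbove j

theorem signOf_dotProduct_self (x : Fin n → Bool) :
    (fun i => signOf (x i)) ⬝ᵥ (fun i => signOf (x i)) = n := by
  simp [dotProduct, ← sq, signOf_sq]

/-- One good start is enough, since the estimate is a maximum; capping at one is harmless because no
eigenvalue exceeds one. -/
theorem IsDensityMatrix.prob_le_upperEstimate (hR : IsDensityMatrix R)
    (hp : ∀ i, 0 < hR.prob i) {δ : ℝ} {i₀ : Fin n} (hmax : ∀ i, hR.prob i ≤ hR.prob i₀)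
    {x : Fin (powerReps δ) → Fin n → Bool}
    (hx : ∃ j, 1 / 4 ≤ (∑ i, (hR.basis i₀).ofLp i * signOf (x j i)) ^ 2) (i : Fin n) :
    hR.prob i ≤ upperEstimate R δ fun j i => signOf (x j i) := by
  obtain ⟨j, hj⟩ := hx
  refine le_min (hR.prob_le_one i) ((hmax i).trans ?_)
  refine (hR.prob_le_rayleigh hp (four_mul_le_exp_powerSteps hR.pos)
    (signOf_dotProduct_self (x j)) hj).trans ?_
  gcongr
  exact rayleigh_le_powerEstimate (R := R) (fun j i => signOf (x j i)) j

theorem measurable_taylorSum (u : ℝ) (m s : ℕ) :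
    Measurable fun g : Fin s → Fin n → ℝ => taylorSum R u m s g := by
  simp only [taylorSum, dotProduct, mulVec]
  fun_prop

theorem measurable_estimate {ℓ ε δ : ℝ} (x : Fin (powerReps δ) → Fin n → ℝ) :
    Measurable (estimate R ℓ ε δ x) := by
  unfold estimate
  exact measurable_taylorSum _ _ _

theorem measurable_coord (hR : IsDensityMatrix R) : Measurable hR.coord := by
  unfold IsDensityMatrix.coord
  simp only [dotProduct]
  fun_prop

/-- Accuracy over the Gaussian vectors for a fixed upper bound on the spectrum. -/
theorem IsDensityMatrix.measure_taylorSum_ge (hR : IsDensityMatrix R) {u ℓ ε δ : ℝ}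
    (hℓ : 0 < ℓ) (hp : ∀ i, ℓ ≤ hR.prob i) (hu : ∀ i, hR.prob i ≤ u) (hu1 : u ≤ 1)
    (hε : 0 < ε) (hε1 : ε < 1) (hδ : 0 < δ) (hδ1 : δ < 1) :
    1 - δ ≤ (gaussianVectors (numGaussians ε δ) n).real
      {g | |taylorSum R u (numTerms u ℓ ε) (numGaussians ε δ) g - hR.entropy|
        ≤ 2 * ε * hR.entropy} := by
  obtain ⟨h0, h1, h2⟩ := hR.taylorEigenvalue_bounds hℓ hp hu hu1 hε
  set a := hR.taylorEigenvalue u (numTerms u ℓ ε)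
  have hc : Measurable fun (g : Fin (numGaussians ε δ) → Fin n → ℝ) j => hR.coord (g j) := by
    have := measurable_coord hR
    fun_prop
  have hconc := measure_quadForm_le h0 hε hε1 hδ hδ1
  rw [← map_coord_gaussianVectors hR, map_measureReal_apply hc
    (measurableSet_le (by fun_prop) measurable_const)] at hconc
  refine hconc.trans (measureReal_mono fun g hg => ?_)
  simp only [Set.preimage_ofPred_eq, Set.mem_ofPred_eq] at hg ⊢
  rw [hR.taylorSum_eq]
  have h3 : ε * ∑ i, a i ≤ ε * hR.entropy := by gcongr
  rw [abs_le] at *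
  constructor <;> linarith [hg.1, hg.2, h2.1, h2.2]

end Entropy

/-- Fubini in place of a union bound: once the signs are fixed in the good event `G`, the numbers
`u` and `m` are constants and the Gaussian estimate applies to the section. -/
theorem mul_le_measureReal_prod {α β : Type*} [MeasurableSpace α] [MeasurableSpace β]
    {μ : Measure α} {ν : Measure β} [IsProbabilityMeasure μ] [IsProbabilityMeasure ν]
    {G : Set α} (hG : MeasurableSet G) {S : Set (α × β)} (hS : MeasurableSet S) {a b : ℝ}
    (hb : 0 ≤ b) (ha : a ≤ μ.real G) (h : ∀ x ∈ G, b ≤ ν.real (Prod.mk x ⁻¹' S)) :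
    a * b ≤ (μ.prod ν).real S := by
  have h1 : ENNReal.ofReal b * μ G ≤ (μ.prod ν) S := by
    rw [Measure.prod_apply hS, ← setLIntegral_const]
    refine (setLIntegral_mono' hG fun x hx => ?_).trans (setLIntegral_le_lintegral _ _)
    rw [← ofReal_measureReal]
    exact ENNReal.ofReal_le_ofReal (h x hx)
  calc a * b ≤ μ.real G * b := by gcongr
    _ = (ENNReal.ofReal b * μ G).toReal := by
        rw [ENNReal.toReal_mul, ENNReal.toReal_ofReal hb, mul_comm]; rfl
    _ ≤ _ := ENNReal.toReal_mono (measure_ne_top _ _) h1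

theorem map_blocks_tapeMeasure (q s n : ℕ) :
    tapeMeasure.map (Prod.map (blocks q n) (blocks s n))
      = (Measure.pi fun _ : Fin q => Measure.pi fun _ : Fin n => coin).prod
        (gaussianVectors s n) := by
  rw [tapeMeasure, ← Measure.map_prod_map _ _ (measurable_blocks q n) (measurable_blocks s n),
    map_blocks_infinitePi, map_blocks_infinitePi]

theorem accuracy {n : ℕ} {R : Matrix (Fin n) (Fin n) ℝ} (hR : IsDensityMatrix R) {ℓ ε δ : ℝ}
    (hℓ : 0 < ℓ) (hp : ∀ i, ℓ ≤ hR.prob i) (hε : 0 < ε) (hε1 : ε < 1) (hδ : 0 < δ) (hδ1 : δ < 1) :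
    1 - 2 * δ ≤ tapeMeasure.real
      {ω | |randomEstimate R ℓ ε δ ω - hR.entropy| ≤ 2 * ε * hR.entropy} := by
  set F : (Fin (powerReps δ) → Fin n → Bool) × (Fin (numGaussians ε δ) → Fin n → ℝ) → ℝ :=
    fun p => estimate R ℓ ε δ (fun j i => signOf (p.1 j i)) p.2 with hF
  -- The sign patterns form a countable space, so measurability in the Gaussians for each fixed
  -- pattern suffices; the dependence of `m` on the signs needs no separate argument.
  have hFm : Measurable F := measurable_from_prod_countable_right fun x =>
    measurable_estimate fun j i => signOf (x j i)
  have hS : MeasurableSet {p | |F p - hR.entropy| ≤ 2 * ε * hR.entropy} :=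
    measurableSet_le (by fun_prop) measurable_const
  have hpre : {ω | |randomEstimate R ℓ ε δ ω - hR.entropy| ≤ 2 * ε * hR.entropy}
      = Prod.map (blocks (powerReps δ) n) (blocks (numGaussians ε δ) n) ⁻¹'
        {p | |F p - hR.entropy| ≤ 2 * ε * hR.entropy} := rfl
  rw [hpre, ← map_measureReal_apply ((measurable_blocks _ _).prodMap (measurable_blocks _ _)) hS,
    map_blocks_tapeMeasure]
  have : Nonempty (Fin n) := ⟨⟨0, hR.pos⟩⟩
  obtain ⟨i₀, hmax⟩ := Finite.exists_max hR.prob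
  have hsigns := measure_exists_signs_ge _ (hR.sum_basis_sq i₀) hδ
  have hsec : ∀ x ∈ {x : Fin (powerReps δ) → Fin n → Bool |
      ∃ j, 1 / 4 ≤ (∑ i, (hR.basis i₀).ofLp i * signOf (x j i)) ^ 2},
      1 - δ ≤ (gaussianVectors (numGaussians ε δ) n).real
        (Prod.mk x ⁻¹' {p | |F p - hR.entropy| ≤ 2 * ε * hR.entropy}) := by
    intro x hx
    have h := hR.measure_taylorSum_ge hℓ hp
      (hR.prob_le_upperEstimate (fun i => hℓ.trans_le (hp i)) hmax hx)
      (min_le_left _ _) hε hε1 hδ hδ1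
    rw [Set.preimage_ofPred_eq]
    simp only [hF, estimate]
    exact h
  have := mul_le_measureReal_prod (Set.to_countable _).measurableSet hS (b := 1 - δ)
    (by linarith) hsigns hsec
  nlinarith [sq_nonneg δ]

/-! ### Semantics of the basic program fragments -/

section State

variable (σ : State) (a i v k : ℕ) (r : ℝ)

@[simp] theorem State.nat_tick : (σ.tick k).nat = σ.nat := rfl
@[simp] theorem State.real_tick : (σ.tick k).real = σ.real := rfl
@[simp] theorem State.flips_tick : (σ.tick k).flips = σ.flips := rfl
@[simp] theorem State.gaussians_tick : (σ.tick k).gaussians = σ.gaussians := rfl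
@[simp] theorem State.time_tick : (σ.tick k).time = σ.time + k := rfl
@[simp] theorem State.nat_setNat_self : (σ.setNat a i v).nat a i = v := by simp [State.setNat]
@[simp] theorem State.real_setNat : (σ.setNat a i v).real = σ.real := rfl
@[simp] theorem State.flips_setNat : (σ.setNat a i v).flips = σ.flips := rfl
@[simp] theorem State.gaussians_setNat : (σ.setNat a i v).gaussians = σ.gaussians := rfl
@[simp] theorem State.time_setNat : (σ.setNat a i v).time = σ.time := rfl
@[simp] theorem State.real_setReal_self : (σ.setReal a i r).real a i = r := by
  simp [State.setReal]
@[simp] theorem State.nat_setReal : (σ.setReal a i r).nat = σ.nat := rfl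
@[simp] theorem State.flips_setReal : (σ.setReal a i r).flips = σ.flips := rfl
@[simp] theorem State.gaussians_setReal : (σ.setReal a i r).gaussians = σ.gaussians := rfl
@[simp] theorem State.time_setReal : (σ.setReal a i r).time = σ.time := rfl

variable {a i}

theorem State.nat_setNat_of_ne {b : ℕ} (h : b ≠ a) : (σ.setNat a i v).nat b = σ.nat b := by
  simp [State.setNat, h]

theorem State.nat_setNat_of_ne_index {j : ℕ} (h : j ≠ i) :
    (σ.setNat a i v).nat a j = σ.nat a j := by
  simp [State.setNat, h]

theorem State.real_setReal_of_ne {b : ℕ} (h : b ≠ a) : (σ.setReal a i r).real b = σ.real b := by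
  simp [State.setReal, h]

theorem State.real_setReal_of_ne_index {j : ℕ} (h : j ≠ i) :
    (σ.setReal a i r).real a j = σ.real a j := by
  simp [State.setReal, h]

end State

/-- Outside of the natural arrays in `N` and the real arrays in `M`, the memory is unchanged. -/
structure Frame (N M : Set ℕ) (σ τ : State) : Prop where
  nat : ∀ a ∉ N, τ.nat a = σ.nat a
  real : ∀ a ∉ M, τ.real a = σ.real a

theorem Frame.refl (N M : Set ℕ) (σ : State) : Frame N M σ σ := ⟨fun _ _ => rfl, fun _ _ => rfl⟩

theorem Frame.comp {N M N' M' : Set ℕ} {σ τ υ : State} (h : Frame N M σ τ)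
    (h' : Frame N' M' τ υ) (hN : N' ⊆ N := by simp) (hM : M' ⊆ M := by simp) :
    Frame N M σ υ where
  nat a ha := (h'.nat a fun h => ha (hN h)).trans (h.nat a ha)
  real a ha := (h'.real a fun h => ha (hM h)).trans (h.real a ha)

theorem run_block_cons (ω : Tape) (p : Program) (ps : List Program) (σ : State) :
    (block (p :: ps)).run ω σ = (block ps).run ω (p.run ω σ) := rfl

theorem run_block_nil (ω : Tape) (σ : State) : (block []).run ω σ = σ.tick 1 := rfl

/-- Induction along a loop. -/
theorem run_loop_induction {ω : Tape} {a : ℕ} {b : NatExpr} {p : Program} {σ : State}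
    (I : ℕ → State → Prop) (h0 : I 0 (σ.tick (b.cost + 1)))
    (hs : ∀ k < b.eval σ, ∀ τ, I k τ → I (k + 1) (p.run ω ((τ.setNat a 0 k).tick 1))) :
    I (b.eval σ) ((Program.loop a b p).run ω σ) := by
  have key : ∀ N ≤ b.eval σ, I N (Nat.rec (motive := fun _ => State) (σ.tick (b.cost + 1))
      (fun k τ => p.run ω ((τ.setNat a 0 k).tick 1)) N) := by
    intro N hN
    induction N with
    | zero => exact h0
    | succ N ih => exact hs N hN _ (ih (by omega))
  exact key _ le_rfl

/-- Filling a vector entry by entry. -/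
theorem run_fill (ω : Tape) {σ : State} {dst : ℕ} {E : RealExpr} (f : ℕ → ℝ)
    (hE : ∀ k < σ.nat 0 0, ∀ τ, Frame {5} {dst} σ τ →
      (∀ i, k ≤ i → τ.real dst i = σ.real dst i) → τ.nat 5 0 = k → E.eval τ = f k) :
    let τ := (Program.loop 5 (nCell 0 0) (.setReal dst (nCell 5 0) E)).run ω σ
    Frame {5} {dst} σ τ ∧ (∀ i < σ.nat 0 0, τ.real dst i = f i) ∧ τ.flips = σ.flips ∧
      τ.gaussians = σ.gaussians ∧ τ.time = σ.time + 3 + σ.nat 0 0 * (E.cost + 4) := by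
  have := run_loop_induction (ω := ω) (a := 5) (b := nCell 0 0)
    (p := .setReal dst (nCell 5 0) E) (σ := σ)
    (fun k τ => Frame {5} {dst} σ τ ∧ (∀ i < k, τ.real dst i = f i) ∧
      (∀ i, k ≤ i → τ.real dst i = σ.real dst i) ∧ τ.flips = σ.flips ∧
      τ.gaussians = σ.gaussians ∧ τ.time = σ.time + 3 + k * (E.cost + 4))
    ⟨⟨fun _ _ => rfl, fun _ _ => rfl⟩, by simp, fun _ _ => rfl, rfl, rfl,
      by simp [NatExpr.cost]⟩ ?_
  · obtain ⟨h1, h2, -, h4, h5, h6⟩ := this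
    exact ⟨h1, h2, h4, h5, h6⟩
  · rintro k hk τ ⟨h1, h2, h3, h4, h5, h6⟩
    set υ := (τ.setNat 5 0 k).tick 1 with hυ
    have hυk : υ.nat 5 0 = k := by simp [hυ]
    have hfr : Frame {5} {dst} σ υ :=
      ⟨fun a ha => (State.nat_setNat_of_ne _ _ (by simpa using ha)).trans (h1.nat a ha),
        h1.real⟩
    have hval := hE k hk υ hfr h3 hυk
    simp only [Program.run, NatExpr.eval, hυk, hval]
    refine ⟨⟨hfr.nat, fun a ha => ?_⟩, fun i hi => ?_, fun i hi => ?_, h4, h5, ?_⟩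
    · exact (State.real_setReal_of_ne _ _ (by simpa using ha)).trans (h1.real a ha)
    · rcases Nat.lt_succ_iff_lt_or_eq.1 hi with h | rfl
      · exact (State.real_setReal_of_ne_index _ _ h.ne).trans (h2 i h)
      · simp
    · exact (State.real_setReal_of_ne_index _ _ (by omega)).trans (h3 i (by omega))
    · simp [hυ, NatExpr.cost, h6]; ring

/-- Drawing a vector of signs. -/
theorem run_drawSigns (ω : Tape) (σ : State) (dst : ℕ) :
    let τ := (Program.loop 5 (nCell 0 0) (.drawSign dst (nCell 5 0))).run ω σ
    Frame {5} {dst} σ τ ∧ (∀ i < σ.nat 0 0, τ.real dst i = signOf (ω.1 (σ.flips + i))) ∧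
      τ.flips = σ.flips + σ.nat 0 0 ∧ τ.gaussians = σ.gaussians ∧
      τ.time = σ.time + 3 + σ.nat 0 0 * 4 := by
  refine run_loop_induction (ω := ω) (a := 5) (b := nCell 0 0)
    (p := .drawSign dst (nCell 5 0)) (σ := σ)
    (fun k τ => Frame {5} {dst} σ τ ∧ (∀ i < k, τ.real dst i = signOf (ω.1 (σ.flips + i))) ∧
      τ.flips = σ.flips + k ∧ τ.gaussians = σ.gaussians ∧ τ.time = σ.time + 3 + k * 4)
    ⟨⟨fun _ _ => rfl, fun _ _ => rfl⟩, by simp, rfl, rfl, by simp [NatExpr.cost]⟩ ?_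
  rintro k hk τ ⟨h1, h2, h3, h4, h5⟩
  simp only [Program.run, NatExpr.eval, State.nat_tick, State.nat_setNat_self,
    State.flips_tick, State.flips_setNat, h3]
  refine ⟨⟨fun a ha => ?_, fun a ha => ?_⟩, fun i hi => ?_, rfl, h4, ?_⟩
  · exact (State.nat_setNat_of_ne _ _ (by simpa using ha)).trans (h1.nat a ha)
  · exact (State.real_setReal_of_ne _ _ (by simpa using ha)).trans (h1.real a ha)
  · rcases Nat.lt_succ_iff_lt_or_eq.1 hi with h | rfl
    · exact (State.real_setReal_of_ne_index _ _ h.ne).trans (h2 i h)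
    · exact State.real_setReal_self _ _ _ _
  · simp [NatExpr.cost, h5]; ring

/-- Drawing a vector of Gaussians. -/
theorem run_drawGaussians (ω : Tape) (σ : State) (dst : ℕ) :
    let τ := (Program.loop 5 (nCell 0 0) (.drawGaussian dst (nCell 5 0))).run ω σ
    Frame {5} {dst} σ τ ∧ (∀ i < σ.nat 0 0, τ.real dst i = ω.2 (σ.gaussians + i)) ∧
      τ.flips = σ.flips ∧ τ.gaussians = σ.gaussians + σ.nat 0 0 ∧
      τ.time = σ.time + 3 + σ.nat 0 0 * 4 := by
  refine run_loop_induction (ω := ω) (a := 5) (b := nCell 0 0)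
    (p := .drawGaussian dst (nCell 5 0)) (σ := σ)
    (fun k τ => Frame {5} {dst} σ τ ∧ (∀ i < k, τ.real dst i = ω.2 (σ.gaussians + i)) ∧
      τ.flips = σ.flips ∧ τ.gaussians = σ.gaussians + k ∧ τ.time = σ.time + 3 + k * 4)
    ⟨⟨fun _ _ => rfl, fun _ _ => rfl⟩, by simp, rfl, rfl, by simp [NatExpr.cost]⟩ ?_
  rintro k hk τ ⟨h1, h2, h3, h4, h5⟩
  simp only [Program.run, NatExpr.eval, State.nat_tick, State.nat_setNat_self,
    State.gaussians_tick, State.gaussians_setNat, h4]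
  refine ⟨⟨fun a ha => ?_, fun a ha => ?_⟩, fun i hi => ?_, h3, rfl, ?_⟩
  · exact (State.nat_setNat_of_ne _ _ (by simpa using ha)).trans (h1.nat a ha)
  · exact (State.real_setReal_of_ne _ _ (by simpa using ha)).trans (h1.real a ha)
  · rcases Nat.lt_succ_iff_lt_or_eq.1 hi with h | rfl
    · exact (State.real_setReal_of_ne_index _ _ h.ne).trans (h2 i h)
    · exact State.real_setReal_self _ _ _ _
  · simp [NatExpr.cost, h5]; ring

/-- Accumulating a sparse matrix-vector product. -/
theorem run_accumulate (ω : Tape) (σ : State) {src dst : ℕ} (hne : src ≠ dst) (hdst : dst ≠ 1) :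
    let τ := (Program.loop 5 (nCell 0 1)
      (.setReal dst (.get 1 (nCell 5 0))
        (.add (.get dst (.get 1 (nCell 5 0)))
          (.mul (.get 1 (nCell 5 0)) (.get src (.get 2 (nCell 5 0))))))).run ω σ
    Frame {5} {dst} σ τ ∧
      (∀ i, τ.real dst i = σ.real dst i + ∑ k ∈ Finset.range (σ.nat 0 1),
        if σ.nat 1 k = i then σ.real 1 k * σ.real src (σ.nat 2 k) else 0) ∧
      τ.flips = σ.flips ∧ τ.gaussians = σ.gaussians ∧ τ.time = σ.time + 3 + σ.nat 0 1 * 18 := by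
  refine run_loop_induction (ω := ω) (a := 5) (b := nCell 0 1) (σ := σ)
    (fun k τ => Frame {5} {dst} σ τ ∧
      (∀ i, τ.real dst i = σ.real dst i + ∑ k ∈ Finset.range k,
        if σ.nat 1 k = i then σ.real 1 k * σ.real src (σ.nat 2 k) else 0) ∧
      τ.flips = σ.flips ∧ τ.gaussians = σ.gaussians ∧ τ.time = σ.time + 3 + k * 18)
    ⟨⟨fun _ _ => rfl, fun _ _ => rfl⟩, by simp, rfl, rfl, by simp [NatExpr.cost]⟩ ?_
  rintro k hk τ ⟨h1, h2, h3, h4, h5⟩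
  have n1 : (τ.setNat 5 0 k).nat 1 = σ.nat 1 :=
    (State.nat_setNat_of_ne _ _ (by norm_num)).trans (h1.nat 1 (by simp))
  have n2 : (τ.setNat 5 0 k).nat 2 = σ.nat 2 :=
    (State.nat_setNat_of_ne _ _ (by norm_num)).trans (h1.nat 2 (by simp))
  have r1 : τ.real 1 = σ.real 1 := h1.real 1 (by simpa using hdst.symm)
  have rs : τ.real src = σ.real src := h1.real src (by simpa using hne)
  simp only [Program.run, NatExpr.eval, RealExpr.eval, State.nat_tick, State.nat_setNat_self,
    State.real_tick, State.real_setNat, n1, n2, r1, rs]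
  refine ⟨⟨fun a ha => ?_, fun a ha => ?_⟩, fun i => ?_, h3, h4, ?_⟩
  · exact (State.nat_setNat_of_ne _ _ (by simpa using ha)).trans (h1.nat a ha)
  · exact (State.real_setReal_of_ne _ _ (by simpa using ha)).trans (h1.real a ha)
  · rw [Finset.sum_range_succ]
    by_cases hi : σ.nat 1 k = i
    · subst hi
      rw [State.real_setReal_self, h2]
      simp [add_assoc]
    · rw [State.real_setReal_of_ne_index _ _ (Ne.symm hi), if_neg hi, add_zero]
      exact h2 i
  · simp [NatExpr.cost, RealExpr.cost, h5]; ring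

/-- The inner product of two vectors. -/
theorem run_dotInto (ω : Tape) (σ : State) {a b c : ℕ} (ha : a ≠ 5) (hb : b ≠ 5) :
    let τ := (dotInto a b c).run ω σ
    Frame {5} {5} σ τ ∧ (∀ i, i ≠ c → τ.real 5 i = σ.real 5 i) ∧
      τ.real 5 c = ∑ i ∈ Finset.range (σ.nat 0 0), σ.real a i * σ.real b i ∧
      τ.flips = σ.flips ∧ τ.gaussians = σ.gaussians ∧
      τ.time = σ.time + 7 + σ.nat 0 0 * 13 := by
  simp only [dotInto, block, Program.run, NatExpr.eval, NatExpr.cost, RealExpr.eval, RealExpr.cost]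
  set σ₁ := (σ.setReal 5 c ((0 : ℚ) : ℝ)).tick (1 + 1 + 1) with hσ₁
  have := run_loop_induction (ω := ω) (a := 5) (b := nCell 0 0) (σ := σ₁)
    (p := .setReal 5 (.const c)
        (.add (rCell 5 c) (.mul (.get a (nCell 5 0)) (.get b (nCell 5 0)))))
    (fun k τ => Frame {5} {5} σ τ ∧ (∀ i, i ≠ c → τ.real 5 i = σ.real 5 i) ∧
      τ.real 5 c = ∑ i ∈ Finset.range k, σ.real a i * σ.real b i ∧
      τ.flips = σ.flips ∧ τ.gaussians = σ.gaussians ∧ τ.time = σ.time + 6 + k * 13)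
    ⟨⟨fun _ _ => rfl, fun _ h => State.real_setReal_of_ne _ _ (by simpa using h)⟩,
      fun i hi => State.real_setReal_of_ne_index (a := 5) σ ((0 : ℚ) : ℝ) hi, by simp [hσ₁], rfl,
      rfl, by simp [hσ₁, NatExpr.cost]⟩ ?_
  · obtain ⟨h1, h2, h3, h4, h5, h6⟩ := this
    refine ⟨⟨h1.nat, h1.real⟩, h2, h3, h4, h5, ?_⟩
    simp only [State.time_tick]
    refine (congrArg (· + 1) h6).trans ?_
    simp [NatExpr.eval, hσ₁]; ring
  · rintro k hk τ ⟨h1, h2, h3, h4, h5, h6⟩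
    have ra : τ.real a = σ.real a := h1.real a (by simpa using ha)
    have rb : τ.real b = σ.real b := h1.real b (by simpa using hb)
    simp only [Program.run, NatExpr.eval, RealExpr.eval, State.nat_tick, State.nat_setNat_self,
      State.real_tick, State.real_setNat, ra, rb, h3]
    refine ⟨⟨fun a ha => ?_, fun a ha => ?_⟩, fun i hi => ?_, ?_, h4, h5, ?_⟩
    · exact (State.nat_setNat_of_ne _ _ (by simpa using ha)).trans (h1.nat a ha)
    · exact (State.real_setReal_of_ne _ _ (by simpa using ha)).trans (h1.real a ha)
    · exact (State.real_setReal_of_ne_index _ _ hi).trans (h2 i hi)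
    · rw [State.real_setReal_self, Finset.sum_range_succ]
    · simp [NatExpr.cost, RealExpr.cost, h6]; ring

/-! ### Sparse matrix-vector products from the coordinate list -/

section Input

variable {n : ℕ} {R : Matrix (Fin n) (Fin n) ℝ}

/-- The input is still in memory. -/
structure HasInput (R : Matrix (Fin n) (Fin n) ℝ) (e : Fin (nnz R) ≃ NonzeroPos R) (ℓ ε δ : ℝ)
    (σ : State) : Prop where
  nat : ∀ a ≤ 2, σ.nat a = (inputState R e ℓ ε δ).nat a
  real : ∀ a ≤ 1, σ.real a = (inputState R e ℓ ε δ).real a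

/-- The first `n` entries of a real array. -/
def State.vec (σ : State) (n a : ℕ) : Fin n → ℝ := fun i => σ.real a i

variable {e : Fin (nnz R) ≃ NonzeroPos R} {ℓ ε δ : ℝ} {σ τ : State}

theorem HasInput.of_frame (h : HasInput R e ℓ ε δ σ) {N M : Set ℕ} (hf : Frame N M σ τ)
    (hN : ∀ a ≤ 2, a ∉ N) (hM : ∀ a ≤ 1, a ∉ M) : HasInput R e ℓ ε δ τ :=
  ⟨fun a ha => (hf.nat a (hN a ha)).trans (h.nat a ha),
    fun a ha => (hf.real a (hM a ha)).trans (h.real a ha)⟩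

theorem HasInput.nat_zero_zero (h : HasInput R e ℓ ε δ σ) : σ.nat 0 0 = n := by
  rw [h.nat 0 (by norm_num)]; rfl

theorem HasInput.nat_zero_one (h : HasInput R e ℓ ε δ σ) : σ.nat 0 1 = nnz R := by
  rw [h.nat 0 (by norm_num)]; rfl

theorem HasInput.row (h : HasInput R e ℓ ε δ σ) (k : Fin (nnz R)) :
    σ.nat 1 k = ((e k).1.1 : ℕ) := by
  rw [h.nat 1 (by norm_num)]; simp [inputState]

theorem HasInput.col (h : HasInput R e ℓ ε δ σ) (k : Fin (nnz R)) :
    σ.nat 2 k = ((e k).1.2 : ℕ) := by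
  rw [h.nat 2 (by norm_num)]; simp [inputState]

theorem HasInput.entry (h : HasInput R e ℓ ε δ σ) (k : Fin (nnz R)) :
    σ.real 1 k = R (e k).1.1 (e k).1.2 := by
  rw [h.real 1 (by norm_num)]; simp [inputState]

/-- Zero entries contribute nothing, and a finite sum does not depend on the order in which `e`
lists the others. -/
theorem sum_nonzero_eq_mulVec (e : Fin (nnz R) ≃ NonzeroPos R) (x : Fin n → ℝ) (i : Fin n) :
    ∑ k, (if (e k).1.1 = i then R (e k).1.1 (e k).1.2 * x (e k).1.2 else 0) = (R *ᵥ x) i := by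
  classical
  rw [e.sum_comp (fun p : NonzeroPos R => if p.1.1 = i then R p.1.1 p.1.2 * x p.1.2 else 0)]
  have h1 : ∑ p : NonzeroPos R, (if p.1.1 = i then R p.1.1 p.1.2 * x p.1.2 else 0)
      = ∑ p : Fin n × Fin n, (if p.1 = i then R p.1 p.2 * x p.2 else 0) := by
    refine (Finset.sum_subtype (Finset.univ.filter fun p : Fin n × Fin n => R p.1 p.2 ≠ 0)
      (by simp) fun p : Fin n × Fin n => if p.1 = i then R p.1 p.2 * x p.2 else 0).symm.trans ?_
    refine Finset.sum_filter_of_ne fun p _ hp h0 => hp ?_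
    simp [h0]
  rw [h1, Fintype.sum_prod_type]
  rw [Finset.sum_eq_single i (fun j _ hj => by simp [hj]) (by simp)]
  simp [mulVec, dotProduct]

/-- The `5n` steps for clearing `dst` are not bounded by the number of nonzero entries of a general
matrix; `IsDensityMatrix.le_nnz` absorbs them later. -/
theorem run_matVec (ω : Tape) (h : HasInput R e ℓ ε δ σ) {src dst : ℕ} (hne : src ≠ dst)
    (hdst : 2 ≤ dst) :
    let τ := (matVec src dst).run ω σ
    Frame {5} {dst} σ τ ∧ τ.vec n dst = R *ᵥ σ.vec n src ∧ τ.flips = σ.flips ∧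
      τ.gaussians = σ.gaussians ∧ τ.time = σ.time + 7 + n * 5 + nnz R * 18 := by
  simp only [matVec, run_block_cons, run_block_nil]
  obtain ⟨f1, v1, l1, g1, t1⟩ := run_fill ω (σ := σ) (dst := dst) (E := .const 0) (fun _ => 0)
    (fun k _ τ _ _ _ => by simp [RealExpr.eval])
  set σ₁ := (Program.loop 5 (nCell 0 0) (.setReal dst (nCell 5 0) (.const 0))).run ω σ
  have h₁ : HasInput R e ℓ ε δ σ₁ := h.of_frame f1
    (fun a ha => by simp; omega) (fun a ha => by simp; omega)
  obtain ⟨f2, v2, l2, g2, t2⟩ := run_accumulate ω σ₁ hne (by omega : dst ≠ 1)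
  set σ₂ := (Program.loop 5 (nCell 0 1) (.setReal dst (.get 1 (nCell 5 0))
      (.add (.get dst (.get 1 (nCell 5 0)))
        (.mul (.get 1 (nCell 5 0)) (.get src (.get 2 (nCell 5 0))))))).run ω σ₁
  have hf : Frame {5} {dst} σ σ₂ := f1.comp f2
  refine ⟨⟨hf.nat, hf.real⟩, ?_, l2.trans l1, g2.trans g1, ?_⟩
  · ext i
    refine (v2 i).trans ?_
    rw [v1 i (by rw [h.nat_zero_zero]; exact i.2), zero_add, h₁.nat_zero_one, Finset.sum_range,
      ← sum_nonzero_eq_mulVec e]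
    refine Finset.sum_congr rfl fun k _ => ?_
    rw [h₁.row, h₁.col, h₁.entry, f1.real src (by simpa using hne)]
    simp only [Fin.val_inj, State.vec]
  · simp only [State.time_tick, t2, t1, RealExpr.cost, h.nat_zero_zero, h₁.nat_zero_one]
    ring

end Input

section Program

variable {n : ℕ} {R : Matrix (Fin n) (Fin n) ℝ} {e : Fin (nnz R) ≃ NonzeroPos R} {ℓ ε δ : ℝ}
  {σ : State}

/-! ### The power method as a program -/

theorem HasInput.real_zero_zero (h : HasInput R e ℓ ε δ σ) : σ.real 0 0 = ℓ := by
  rw [h.real 0 (by norm_num)]; rfl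

theorem HasInput.real_zero_one (h : HasInput R e ℓ ε δ σ) : σ.real 0 1 = ε := by
  rw [h.real 0 (by norm_num)]; rfl

theorem HasInput.real_zero_two (h : HasInput R e ℓ ε δ σ) : σ.real 0 2 = δ := by
  rw [h.real 0 (by norm_num)]; rfl

theorem HasInput.sum_range_eq (h : HasInput R e ℓ ε δ σ) (τ : State) (a b : ℕ) :
    ∑ i ∈ Finset.range (σ.nat 0 0), τ.real a i * τ.real b i = τ.vec n a ⬝ᵥ τ.vec n b := by
  rw [h.nat_zero_zero, Finset.sum_range]; rfl

theorem Frame.vec {N M : Set ℕ} {σ τ : State} (h : Frame N M σ τ) {a : ℕ} (ha : a ∉ M) :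
    τ.vec n a = σ.vec n a := by
  unfold State.vec; rw [h.real a ha]

theorem frame_setNat (a i v k : ℕ) (σ : State) : Frame {a} ∅ σ ((σ.setNat a i v).tick k) :=
  ⟨fun _ hb => State.nat_setNat_of_ne _ _ (by simpa using hb), fun _ _ => rfl⟩

theorem frame_setReal (a i : ℕ) (r : ℝ) (k : ℕ) (σ : State) :
    Frame ∅ {a} σ ((σ.setReal a i r).tick k) :=
  ⟨fun _ _ => rfl, fun _ hb => State.real_setReal_of_ne _ _ (by simpa using hb)⟩

theorem frame_tick (k : ℕ) (σ : State) : Frame ∅ ∅ σ (σ.tick k) := ⟨fun _ _ => rfl, fun _ _ => rfl⟩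

theorem run_setParameters (ω : Tape) (h : HasInput R e ℓ ε δ σ) :
    let τ := setParameters.run ω σ
    Frame {6} ∅ σ τ ∧ τ.nat 6 0 = powerReps δ ∧ τ.nat 6 1 = powerSteps n ∧
      τ.nat 6 2 = numGaussians ε δ ∧ τ.flips = σ.flips ∧ τ.gaussians = σ.gaussians ∧
      τ.time = σ.time + 35 := by
  have q1 : ((482 / 100 : ℚ) : ℝ) * Real.log (((1 : ℚ) : ℝ) / δ) = 4.82 * Real.log (1 / δ) := by
    norm_num
  -- The machine has no square root, so the program halves the logarithm instead.
  have q2 : Real.log (((4 : ℚ) : ℝ) * (n : ℝ)) / ((2 : ℚ) : ℝ) = Real.log √(4 * (n : ℝ)) := by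
    rw [Real.log_sqrt (by positivity)]; norm_num
  have q3 : ((20 : ℚ) : ℝ) * Real.log (((2 : ℚ) : ℝ) / δ) / (ε * ε)
      = 20 * Real.log (2 / δ) / ε ^ 2 := by rw [sq]; norm_num
  simp only [setParameters, run_block_cons, run_block_nil, Program.run, NatExpr.eval, NatExpr.cost,
    RealExpr.eval, RealExpr.cost, State.real_tick, State.real_setNat, State.nat_tick,
    State.nat_setNat_of_ne _ _ (show (0 : ℕ) ≠ 6 by norm_num), h.nat_zero_zero, h.real_zero_one,
    h.real_zero_two, q1, q2, q3]
  refine ⟨?_, ?_, ?_, ?_, rfl, rfl, rfl⟩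
  · exact ((((Frame.refl {6} ∅ σ).comp (frame_setNat _ _ _ _ _)).comp
      (frame_setNat _ _ _ _ _)).comp (frame_setNat _ _ _ _ _)).comp (frame_tick _ _)
  all_goals simp [State.setNat, State.tick, powerReps, powerSteps, numGaussians]

theorem run_copy (ω : Tape) (h : HasInput R e ℓ ε δ σ) {src dst : ℕ} (hne : src ≠ dst) :
    let τ := (Program.loop 5 (nCell 0 0)
      (.setReal dst (nCell 5 0) (.get src (nCell 5 0)))).run ω σ
    Frame {5} {dst} σ τ ∧ τ.vec n dst = σ.vec n src ∧ τ.flips = σ.flips ∧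
      τ.gaussians = σ.gaussians ∧ τ.time = σ.time + 3 + n * 7 := by
  obtain ⟨f, v, l, g, t⟩ := run_fill ω (σ := σ) (dst := dst) (E := .get src (nCell 5 0))
    (σ.real src) fun k _ τ hf _ hk => by
      simp only [RealExpr.eval, NatExpr.eval, hk, hf.real src (by simpa using hne)]
  refine ⟨f, ?_, l, g, ?_⟩
  · ext i
    exact v i (by rw [h.nat_zero_zero]; exact i.2)
  · rw [t, h.nat_zero_zero]; rfl

theorem run_powerSteps (ω : Tape) (h : HasInput R e ℓ ε δ σ) :
    let τ := (Program.loop 4 (nCell 6 1) (block [matVec 2 3,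
        .loop 5 (nCell 0 0) (.setReal 2 (nCell 5 0) (.get 3 (nCell 5 0)))])).run ω σ
    Frame {4, 5} {2, 3} σ τ ∧
      τ.vec n 2 = (fun v => R *ᵥ v)^[σ.nat 6 1] (σ.vec n 2) ∧ τ.flips = σ.flips ∧
      τ.gaussians = σ.gaussians ∧
      τ.time = σ.time + 3 + σ.nat 6 1 * (12 + n * 12 + nnz R * 18) := by
  refine run_loop_induction (ω := ω) (a := 4) (b := nCell 6 1) (σ := σ)
    (fun k τ => Frame {4, 5} {2, 3} σ τ ∧
      τ.vec n 2 = (fun v => R *ᵥ v)^[k] (σ.vec n 2) ∧ τ.flips = σ.flips ∧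
      τ.gaussians = σ.gaussians ∧ τ.time = σ.time + 3 + k * (12 + n * 12 + nnz R * 18))
    ⟨⟨fun _ _ => rfl, fun _ _ => rfl⟩, rfl, rfl, rfl, by simp [NatExpr.cost]⟩ ?_
  rintro k - τ ⟨f, v, l, g, t⟩
  have f₀ : Frame {4, 5} {2, 3} σ ((τ.setNat 4 0 k).tick 1) := f.comp (frame_setNat _ _ _ _ _)
  have h₀ := h.of_frame f₀ (fun a ha => by simp; omega) (fun a ha => by simp; omega)
  have t₀ : ((τ.setNat 4 0 k).tick 1).time = τ.time + 1 := rfl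
  have v₀ : ((τ.setNat 4 0 k).tick 1).vec n 2 = τ.vec n 2 := rfl
  have l₀ : ((τ.setNat 4 0 k).tick 1).flips = τ.flips := rfl
  have g₀ : ((τ.setNat 4 0 k).tick 1).gaussians = τ.gaussians := rfl
  generalize (τ.setNat 4 0 k).tick 1 = τ₀ at *
  simp only [run_block_cons, run_block_nil]
  obtain ⟨f₁, v₁, l₁, g₁, t₁⟩ := run_matVec ω h₀ (show 2 ≠ 3 by norm_num) (by norm_num)
  have h₁ := h₀.of_frame f₁ (fun a ha => by simp; omega) (fun a ha => by simp; omega)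
  generalize (matVec 2 3).run ω τ₀ = τ₁ at *
  obtain ⟨f₂, v₂, l₂, g₂, t₂⟩ := run_copy ω h₁ (show 3 ≠ 2 by norm_num)
  generalize (Program.loop 5 (nCell 0 0) (.setReal 2 (nCell 5 0) (.get 3 (nCell 5 0)))).run ω τ₁
    = τ₂ at *
  refine ⟨((f₀.comp f₁).comp f₂).comp (frame_tick 1 τ₂), ?_,
    ?_, ?_, ?_⟩
  · refine v₂.trans ?_
    rw [v₁, v₀, v, Function.iterate_succ_apply']
  · simp [l₂, l₁, l₀, l]
  · simp [g₂, g₁, g₀, g]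
  · simp only [State.time_tick, t₂, t₁, t₀, t]; ring

/-- The body of the power loop. -/
def powerBody : Program :=
  block [
      .loop 5 (nCell 0 0) (.drawSign 2 (nCell 5 0)),
      .loop 4 (nCell 6 1) (block [
        matVec 2 3,
        .loop 5 (nCell 0 0) (.setReal 2 (nCell 5 0) (.get 3 (nCell 5 0)))]),
      matVec 2 3,
      dotInto 2 3 1,
      dotInto 2 2 2,
      .setReal 5 (.const 1) (.div (rCell 5 1) (rCell 5 2)),
      .ifLe (rCell 5 0) (rCell 5 1) (.setReal 5 (.const 0) (rCell 5 1)) .skip]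

/-- The time is only bounded above because the two branches of the comparison cost different
amounts; `50` is rounded up. -/
theorem run_powerBody (ω : Tape) (h : HasInput R e ℓ ε δ σ) :
    let τ := powerBody.run ω σ
    Frame {4, 5} {2, 3, 5} σ τ ∧
      τ.real 5 0 = max (σ.real 5 0) (rayleigh R ((fun v => R *ᵥ v)^[σ.nat 6 1]
        (fun i => signOf (ω.1 (σ.flips + i))))) ∧
      τ.flips = σ.flips + n ∧ τ.gaussians = σ.gaussians ∧
      τ.time ≤ σ.time + (50 + n * 35 + nnz R * 18 +
        σ.nat 6 1 * (12 + n * 12 + nnz R * 18)) := by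
  simp only [powerBody, run_block_cons, run_block_nil]
  obtain ⟨f₁, v₁, l₁, g₁, t₁⟩ := run_drawSigns ω σ 2
  have h₁ := h.of_frame f₁ (fun a ha => by simp; omega) (fun a ha => by simp; omega)
  rw [h.nat_zero_zero] at v₁ l₁ t₁
  generalize (Program.loop 5 (nCell 0 0) (.drawSign 2 (nCell 5 0))).run ω σ = τ₁ at *
  have v₁' : τ₁.vec n 2 = fun i : Fin n => signOf (ω.1 (σ.flips + i)) :=
    funext fun i => v₁ i i.2
  obtain ⟨f₂, v₂, l₂, g₂, t₂⟩ := run_powerSteps ω h₁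
  have h₂ := h₁.of_frame f₂ (fun a ha => by simp; omega) (fun a ha => by simp; omega)
  generalize (Program.loop 4 (nCell 6 1) (block [matVec 2 3,
    .loop 5 (nCell 0 0) (.setReal 2 (nCell 5 0) (.get 3 (nCell 5 0)))])).run ω τ₁ = τ₂ at *
  obtain ⟨f₃, v₃, l₃, g₃, t₃⟩ := run_matVec ω h₂ (show 2 ≠ 3 by norm_num) (by norm_num)
  have h₃ := h₂.of_frame f₃ (fun a ha => by simp; omega) (fun a ha => by simp; omega)
  generalize (matVec 2 3).run ω τ₂ = τ₃ at *
  obtain ⟨f₄, w₄, v₄, l₄, g₄, t₄⟩ :=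
    run_dotInto ω τ₃ (a := 2) (b := 3) (c := 1) (by norm_num) (by norm_num)
  have h₄ := h₃.of_frame f₄ (fun a ha => by simp; omega) (fun a ha => by simp; omega)
  rw [h₃.sum_range_eq] at v₄
  generalize (dotInto 2 3 1).run ω τ₃ = τ₄ at *
  obtain ⟨f₅, w₅, v₅, l₅, g₅, t₅⟩ :=
    run_dotInto ω τ₄ (a := 2) (b := 2) (c := 2) (by norm_num) (by norm_num)
  rw [h₄.sum_range_eq] at v₅
  generalize (dotInto 2 2 2).run ω τ₄ = τ₅ at *
  rw [f₁.nat 6 (by simp)] at v₂ t₂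
  rw [h₃.nat_zero_zero] at t₄
  rw [h₄.nat_zero_zero] at t₅
  set y := (fun v => R *ᵥ v)^[σ.nat 6 1] (fun i : Fin n => signOf (ω.1 (σ.flips + i))) with hy
  have y₂ : τ₂.vec n 2 = y := by rw [v₂, v₁']
  have y₃ : τ₃.vec n 2 = y := by rw [f₃.vec (by simp), y₂]
  have y₄ : τ₄.vec n 2 = y := by rw [f₄.vec (by simp), y₃]
  have c1 : τ₅.real 5 1 / τ₅.real 5 2 = rayleigh R y := by
    rw [w₅ 1 (by norm_num), v₄, v₅, y₄, y₃, v₃, y₂]; rfl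
  have c0 : τ₅.real 5 0 = σ.real 5 0 := by
    rw [w₅ 0 (by norm_num), w₄ 0 (by norm_num), f₃.real 5 (by simp), f₂.real 5 (by simp),
      f₁.real 5 (by simp)]
  have hf : Frame {4, 5} {2, 3, 5} σ τ₅ :=
    (((((Frame.refl _ _ σ).comp f₁).comp f₂).comp f₃).comp f₄).comp f₅
  have hl : τ₅.flips = σ.flips + n := by rw [l₅, l₄, l₃, l₂, l₁]
  have hg : τ₅.gaussians = σ.gaussians := by rw [g₅, g₄, g₃, g₂, g₁]
  have ht : τ₅.time = σ.time + (27 + n * 35 + nnz R * 18 +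
        σ.nat 6 1 * (12 + n * 12 + nnz R * 18)) := by rw [t₅, t₄, t₃, t₂, t₁]; ring
  simp only [Program.run, NatExpr.eval, NatExpr.cost, RealExpr.eval, RealExpr.cost, c1,
    State.real_tick, State.real_setReal_self]
  rw [State.real_setReal_of_ne_index _ _ (show 0 ≠ 1 by norm_num), c0]
  split_ifs with hle
  · refine ⟨?_, ?_, hl, hg, ?_⟩
    · exact (((hf.comp (frame_setReal _ _ _ _ _)).comp (frame_tick _ _)).comp
        (frame_setReal _ _ _ _ _)).comp (frame_tick _ _)
    · simp [max_eq_right hle]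
    · simp [ht]; omega
  · refine ⟨?_, ?_, hl, hg, ?_⟩
    · exact (((hf.comp (frame_setReal _ _ _ _ _)).comp (frame_tick _ _)).comp
        (frame_tick _ _)).comp (frame_tick _ _)
    · simp only [State.real_tick]
      rw [max_eq_left (not_le.1 hle).le,
        State.real_setReal_of_ne_index _ _ (show 0 ≠ 1 by norm_num), c0]
    · simp [ht]; omega

/-- The running maximum starts at zero, so the invariant says that it dominates all quotients so far
and is either one of them or still zero; nonnegativity of the quotients settles the second case. The
flip counter `k * n` makes round `k` read exactly the `k`-th sign vector. -/
theorem run_powerProgram (ω : Tape) (hR : IsDensityMatrix R) (h : HasInput R e ℓ ε δ σ)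
    (hq : 0 < σ.nat 6 0) (hfl : σ.flips = 0) :
    let τ := powerProgram.run ω σ
    Frame {3, 4, 5} {2, 3, 5} σ τ ∧
      τ.real 5 0 = powerEstimate R (σ.nat 6 0) (σ.nat 6 1) (fun j => signVec n ω j) ∧
      τ.gaussians = σ.gaussians ∧
      τ.time ≤ σ.time + 7 + σ.nat 6 0 * (51 + n * 35 + nnz R * 18 +
        σ.nat 6 1 * (12 + n * 12 + nnz R * 18)) := by
  set f : ℕ → ℝ := fun j => rayleigh R ((fun v => R *ᵥ v)^[σ.nat 6 1] (signVec n ω j)) with hf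
  set B := 51 + n * 35 + nnz R * 18 + σ.nat 6 1 * (12 + n * 12 + nnz R * 18) with hB
  have hrun : powerProgram.run ω σ = ((Program.loop 3 (nCell 6 0) powerBody).run ω
      ((Program.setReal 5 (.const 0) (.const 0)).run ω σ)).tick 1 := rfl
  have hrun₀ : (Program.setReal 5 (.const 0) (.const 0)).run ω σ = (σ.setReal 5 0 0).tick 3 := by
    simp [Program.run, NatExpr.eval, RealExpr.eval, NatExpr.cost, RealExpr.cost]
  rw [hrun, hrun₀]
  have key := run_loop_induction (ω := ω) (a := 3) (b := nCell 6 0) (p := powerBody)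
    (σ := (σ.setReal 5 0 0).tick 3)
    (fun k τ => Frame {3, 4, 5} {2, 3, 5} σ τ ∧ 0 ≤ τ.real 5 0 ∧ (∀ j < k, f j ≤ τ.real 5 0) ∧
      (τ.real 5 0 = 0 ∨ ∃ j < k, τ.real 5 0 = f j) ∧ τ.flips = k * n ∧
      τ.gaussians = σ.gaussians ∧ τ.time ≤ σ.time + 6 + k * B)
    ⟨((Frame.refl _ _ σ).comp (frame_setReal 5 0 0 3 σ)).comp (frame_tick _ _), by simp, by simp,
      by simp, by simp [hfl], rfl, by simp [NatExpr.cost]⟩ ?_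
  · have hev : NatExpr.eval ((σ.setReal 5 0 0).tick 3) (nCell 6 0) = σ.nat 6 0 := rfl
    rw [hev] at key
    obtain ⟨k1, k2, k3, k4, -, k6, k7⟩ := key
    refine ⟨k1.comp (frame_tick _ _), ?_, k6, ?_⟩
    · have hne : Nonempty (Fin (σ.nat 6 0)) := ⟨⟨0, hq⟩⟩
      have hsup : ∀ j < σ.nat 6 0,
          f j ≤ powerEstimate R (σ.nat 6 0) (σ.nat 6 1) (fun j => signVec n ω j) := fun j hj =>
        rayleigh_le_powerEstimate (R := R) (fun j : Fin (σ.nat 6 0) => signVec n ω j) ⟨j, hj⟩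
      rw [State.real_tick]
      refine le_antisymm ?_ (ciSup_le fun j => k3 j j.2)
      rcases k4 with k4 | ⟨j, hj, k4⟩
      · rw [k4]; exact (hR.rayleigh_nonneg _ _).trans (hsup 0 hq)
      · rw [k4]; exact hsup j hj
    · simp only [State.time_tick]; omega
  · rintro k - τ ⟨k1, k2, k3, k4, k5, k6, k7⟩
    have f₀ : Frame {3, 4, 5} {2, 3, 5} σ ((τ.setNat 3 0 k).tick 1) :=
      k1.comp (frame_setNat _ _ _ _ _)
    have h₀ := h.of_frame f₀ (fun a ha => by simp; omega) (fun a ha => by simp; omega)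
    obtain ⟨m1, m2, m3, m4, m5⟩ := run_powerBody ω h₀
    have r₀ : ((τ.setNat 3 0 k).tick 1).real = τ.real := rfl
    have l₀ : ((τ.setNat 3 0 k).tick 1).flips = τ.flips := rfl
    have g₀ : ((τ.setNat 3 0 k).tick 1).gaussians = τ.gaussians := rfl
    have t₀ : ((τ.setNat 3 0 k).tick 1).time = τ.time + 1 := rfl
    rw [f₀.nat 6 (by simp)] at m2 m5
    rw [r₀, l₀, k5] at m2
    have m2' : (powerBody.run ω ((τ.setNat 3 0 k).tick 1)).real 5 0 = max (τ.real 5 0) (f k) := m2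
    refine ⟨f₀.comp m1, ?_, fun j hj => ?_, ?_, ?_, ?_, ?_⟩
    · rw [m2']; exact k2.trans (le_max_left _ _)
    · rw [m2']
      rcases Nat.lt_succ_iff_lt_or_eq.1 hj with hj | rfl
      · exact (k3 j hj).trans (le_max_left _ _)
      · exact le_max_right _ _
    · rw [m2']
      rcases max_choice (τ.real 5 0) (f k) with hm | hm <;> rw [hm]
      · rcases k4 with k4 | ⟨j, hj, k4⟩
        · exact Or.inl k4
        · exact Or.inr ⟨j, by omega, k4⟩
      · exact Or.inr ⟨k, by omega, rfl⟩
    · rw [m3, l₀, k5]; ring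
    · rw [m4, g₀, k6]
    · rw [t₀] at m5
      refine m5.trans ?_
      have : (k + 1) * B = k * B + B := by ring
      omega

theorem run_setUpper (ω : Tape) (h : HasInput R e ℓ ε δ σ) :
    let τ := setUpper.run ω σ
    Frame {6} {5} σ τ ∧ τ.real 5 3 = min 1 (6 * σ.real 5 0) ∧
      τ.nat 6 2 = σ.nat 6 2 ∧ τ.nat 6 3 = numTerms (min 1 (6 * σ.real 5 0)) ℓ ε ∧
      τ.gaussians = σ.gaussians ∧ τ.time ≤ σ.time + 40 := by
  have q1 : ((1 : ℚ) : ℝ) = 1 := Rat.cast_one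
  have q6 : ((6 : ℚ) : ℝ) = 6 := by norm_num
  simp only [setUpper, run_block_cons, run_block_nil, Program.run, NatExpr.eval, NatExpr.cost,
    RealExpr.eval, RealExpr.cost, State.real_tick, State.real_setReal_self, q1, q6]
  split_ifs with hle
  · rw [min_eq_left hle]
    refine ⟨((((((Frame.refl _ _ σ).comp (frame_setReal _ _ _ _ _)).comp (frame_tick _ _)).comp
      (frame_setReal _ _ _ _ _)).comp (frame_setNat _ _ _ _ _)).comp (frame_tick _ _)), ?_, ?_,
      ?_, rfl, ?_⟩
    · simp
    · simp [State.nat_setNat_of_ne_index]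
    · simp [numTerms, State.real_setReal_of_ne, h.real_zero_zero, h.real_zero_one]
    · simp
  · rw [min_eq_right (not_le.1 hle).le]
    refine ⟨((((((Frame.refl _ _ σ).comp (frame_setReal _ _ _ _ _)).comp (frame_tick _ _)).comp
      (frame_tick _ _)).comp (frame_setNat _ _ _ _ _)).comp (frame_tick _ _)), ?_, ?_,
      ?_, rfl, ?_⟩
    · simp
    · simp [State.nat_setNat_of_ne_index]
    · simp [numTerms, State.real_setReal_of_ne, h.real_zero_zero, h.real_zero_one]
    · simp

/-! ### The trace estimator as a program -/

/-- The update is in place: when entry `k` is computed, the entries from `k` on still hold their old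
values, which is what the extra hypothesis offered by `run_fill` provides. -/
theorem run_subScaled (ω : Tape) (h : HasInput R e ℓ ε δ σ) :
    let τ := (Program.loop 5 (nCell 0 0)
          (.setReal 2 (nCell 5 0)
            (.sub (.get 2 (nCell 5 0)) (.div (.get 3 (nCell 5 0)) (rCell 5 3))))).run ω σ
    Frame {5} {2} σ τ ∧ τ.vec n 2 = σ.vec n 2 - (σ.real 5 3)⁻¹ • σ.vec n 3 ∧ τ.flips = σ.flips ∧
      τ.gaussians = σ.gaussians ∧ τ.time = σ.time + 3 + n * 14 := by
  obtain ⟨f, v, l, g, t⟩ := run_fill ω (σ := σ) (dst := 2)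
    (E := .sub (.get 2 (nCell 5 0)) (.div (.get 3 (nCell 5 0)) (rCell 5 3)))
    (fun k => σ.real 2 k - σ.real 3 k / σ.real 5 3) fun k _ τ hf hr hk => by
      simp only [RealExpr.eval, NatExpr.eval, hk, hf.real 3 (by simp), hf.real 5 (by simp),
        hr k le_rfl]
  refine ⟨f, ?_, l, g, ?_⟩
  · ext i
    refine (v i (by rw [h.nat_zero_zero]; exact i.2)).trans ?_
    simp only [State.vec, Pi.sub_apply, Pi.smul_apply, smul_eq_mul]
    ring
  · rw [t, h.nat_zero_zero]; rfl

/-- The body of the loop over the Taylor terms. -/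
def termBody : Program :=
  block [
        matVec 2 3,
        .loop 5 (nCell 0 0)
          (.setReal 2 (nCell 5 0)
            (.sub (.get 2 (nCell 5 0)) (.div (.get 3 (nCell 5 0)) (rCell 5 3)))),
        dotInto 4 2 1,
        .setReal 5 (.const 4)
          (.add (rCell 5 4)
            (.div (rCell 5 1) (.ofNat (.add (nCell 4 0) (.const 1)))))]

theorem run_termBody (ω : Tape) (h : HasInput R e ℓ ε δ σ) :
    let τ := termBody.run ω σ
    Frame {5} {2, 3, 5} σ τ ∧ τ.real 5 3 = σ.real 5 3 ∧
      τ.vec n 2 = (1 - (σ.real 5 3)⁻¹ • R) *ᵥ σ.vec n 2 ∧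
      τ.real 5 4 = σ.real 5 4 + (σ.vec n 4 ⬝ᵥ (1 - (σ.real 5 3)⁻¹ • R) *ᵥ σ.vec n 2)
        / ((σ.nat 4 0 : ℝ) + 1) ∧
      τ.flips = σ.flips ∧ τ.gaussians = σ.gaussians ∧
      τ.time = σ.time + (31 + n * 32 + nnz R * 18) := by
  simp only [termBody, run_block_cons, run_block_nil]
  obtain ⟨f₁, v₁, l₁, g₁, t₁⟩ := run_matVec ω h (show 2 ≠ 3 by norm_num) (by norm_num)
  have h₁ := h.of_frame f₁ (fun a ha => by simp; omega) (fun a ha => by simp; omega)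
  generalize (matVec 2 3).run ω σ = τ₁ at *
  obtain ⟨f₂, v₂, l₂, g₂, t₂⟩ := run_subScaled ω h₁
  have h₂ := h₁.of_frame f₂ (fun a ha => by simp; omega) (fun a ha => by simp; omega)
  generalize (Program.loop 5 (nCell 0 0) (.setReal 2 (nCell 5 0)
    (.sub (.get 2 (nCell 5 0)) (.div (.get 3 (nCell 5 0)) (rCell 5 3))))).run ω τ₁ = τ₂ at *
  obtain ⟨f₃, w₃, v₃, l₃, g₃, t₃⟩ :=
    run_dotInto ω τ₂ (a := 4) (b := 2) (c := 1) (by norm_num) (by norm_num)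
  rw [h₂.sum_range_eq] at v₃
  rw [h₂.nat_zero_zero] at t₃
  generalize (dotInto 4 2 1).run ω τ₂ = τ₃ at *
  have hf : Frame {5} {2, 3, 5} σ τ₃ := (((Frame.refl _ _ σ).comp f₁).comp f₂).comp f₃
  have y₂ : τ₂.vec n 2 = (1 - (σ.real 5 3)⁻¹ • R) *ᵥ σ.vec n 2 := by
    rw [v₂, f₁.vec (by simp), f₁.real 5 (by simp), v₁, sub_mulVec, one_mulVec, smul_mulVec]
  have y₃ : τ₃.vec n 2 = (1 - (σ.real 5 3)⁻¹ • R) *ᵥ σ.vec n 2 := by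
    rw [f₃.vec (by simp), y₂]
  have c1 : τ₃.real 5 1 = σ.vec n 4 ⬝ᵥ (1 - (σ.real 5 3)⁻¹ • R) *ᵥ σ.vec n 2 := by
    rw [v₃, y₂, f₂.vec (by simp), f₁.vec (by simp)]
  have c : ∀ i, i ≠ 1 → τ₃.real 5 i = σ.real 5 i := fun i hi => by
    rw [w₃ i hi, f₂.real 5 (by simp), f₁.real 5 (by simp)]
  have k4 : τ₃.nat 4 0 = σ.nat 4 0 := by rw [hf.nat 4 (by simp)]
  simp only [Program.run, NatExpr.eval, NatExpr.cost, RealExpr.eval, RealExpr.cost,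
    State.real_tick, c1, k4, c 4 (by norm_num), Nat.cast_add, Nat.cast_one]
  refine ⟨(hf.comp (frame_setReal _ _ _ _ _)).comp (frame_tick _ _), ?_, ?_, ?_, ?_, ?_, ?_⟩
  · rw [State.real_setReal_of_ne_index _ _ (show 3 ≠ 4 by norm_num), c 3 (by norm_num)]
  · rw [← y₃]
    funext i
    simp [State.vec, State.real_setReal_of_ne]
  · simp
  · exact l₃.trans (l₂.trans l₁)
  · exact g₃.trans (g₂.trans g₁)
  · simp [t₃, t₂, t₁]; ring

theorem run_termLoop (ω : Tape) (h : HasInput R e ℓ ε δ σ) :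
    let τ := (Program.loop 4 (nCell 6 3) termBody).run ω σ
    Frame {4, 5} {2, 3, 5} σ τ ∧ τ.real 5 3 = σ.real 5 3 ∧
      τ.real 5 4 = σ.real 5 4 + ∑ k ∈ Finset.range (σ.nat 6 3),
        (σ.vec n 4 ⬝ᵥ (1 - (σ.real 5 3)⁻¹ • R) ^ (k + 1) *ᵥ σ.vec n 2) / ((k : ℝ) + 1) ∧
      τ.flips = σ.flips ∧ τ.gaussians = σ.gaussians ∧
      τ.time = σ.time + 3 + σ.nat 6 3 * (32 + n * 32 + nnz R * 18) := by
  have key := run_loop_induction (ω := ω) (a := 4) (b := nCell 6 3) (p := termBody) (σ := σ)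
    (fun k τ => Frame {4, 5} {2, 3, 5} σ τ ∧ τ.real 5 3 = σ.real 5 3 ∧
      τ.vec n 2 = (1 - (σ.real 5 3)⁻¹ • R) ^ k *ᵥ σ.vec n 2 ∧
      τ.real 5 4 = σ.real 5 4 + ∑ k ∈ Finset.range k,
        (σ.vec n 4 ⬝ᵥ (1 - (σ.real 5 3)⁻¹ • R) ^ (k + 1) *ᵥ σ.vec n 2) / ((k : ℝ) + 1) ∧
      τ.flips = σ.flips ∧ τ.gaussians = σ.gaussians ∧
      τ.time = σ.time + 3 + k * (32 + n * 32 + nnz R * 18))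
    ⟨⟨fun _ _ => rfl, fun _ _ => rfl⟩, rfl, by simp; rfl, by simp, rfl, rfl,
      by simp [NatExpr.cost]⟩ ?_
  · obtain ⟨k1, k2, -, k4, k5, k6, k7⟩ := key
    exact ⟨k1, k2, k4, k5, k6, k7⟩
  · rintro k - τ ⟨k1, k2, k3, k4, k5, k6, k7⟩
    have f₀ : Frame {4, 5} {2, 3, 5} σ ((τ.setNat 4 0 k).tick 1) :=
      k1.comp (frame_setNat _ _ _ _ _)
    have h₀ := h.of_frame f₀ (fun a ha => by simp; omega) (fun a ha => by simp; omega)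
    obtain ⟨m1, m2, m3, m4, m5, m6, m7⟩ := run_termBody ω h₀
    have r₀ : ((τ.setNat 4 0 k).tick 1).real = τ.real := rfl
    have v₀ : ((τ.setNat 4 0 k).tick 1).vec n 2 = τ.vec n 2 := rfl
    have c₀ : ((τ.setNat 4 0 k).tick 1).nat 4 0 = k := by simp
    have t₀ : ((τ.setNat 4 0 k).tick 1).time = τ.time + 1 := rfl
    rw [f₀.vec (a := 4) (by simp)] at m4
    rw [r₀, k2] at m2
    rw [r₀, v₀, k2, k3, mulVec_mulVec, ← pow_succ'] at m3
    rw [r₀, v₀, c₀, k2, k3, k4, mulVec_mulVec, ← pow_succ', add_assoc,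
      ← Finset.sum_range_succ (fun k => (σ.vec n 4 ⬝ᵥ (1 - (σ.real 5 3)⁻¹ • R) ^ (k + 1) *ᵥ
        σ.vec n 2) / ((k : ℝ) + 1))] at m4
    refine ⟨f₀.comp m1, m2, m3, m4, m5.trans k5, m6.trans k6, ?_⟩
    rw [m7, t₀, k7]; ring

/-- The body of the loop over the Gaussian vectors. -/
def traceBody : Program :=
  block [
      .loop 5 (nCell 0 0) (.drawGaussian 2 (nCell 5 0)),
      matVec 2 4,
      .loop 4 (nCell 6 3) termBody]

theorem run_traceBody (ω : Tape) (hR : IsDensityMatrix R) (h : HasInput R e ℓ ε δ σ) {g : Fin n → ℝ}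
    (hg : g = fun i : Fin n => ω.2 (σ.gaussians + i)) :
    let τ := traceBody.run ω σ
    Frame {4, 5} {2, 3, 4, 5} σ τ ∧ τ.real 5 3 = σ.real 5 3 ∧
      τ.real 5 4 = σ.real 5 4 + ∑ k ∈ Finset.Icc 1 (σ.nat 6 3),
        (g ⬝ᵥ (R * (1 - (σ.real 5 3)⁻¹ • R) ^ k) *ᵥ g) / (k : ℝ) ∧
      τ.gaussians = σ.gaussians + n ∧
      τ.time = σ.time + (14 + n * 9 + nnz R * 18 +
        σ.nat 6 3 * (32 + n * 32 + nnz R * 18)) := by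
  simp only [traceBody, run_block_cons, run_block_nil]
  obtain ⟨f₁, v₁, l₁, g₁, t₁⟩ := run_drawGaussians ω σ 2
  have h₁ := h.of_frame f₁ (fun a ha => by simp; omega) (fun a ha => by simp; omega)
  rw [h.nat_zero_zero] at v₁ g₁ t₁
  generalize (Program.loop 5 (nCell 0 0) (.drawGaussian 2 (nCell 5 0))).run ω σ = τ₁ at *
  have v₁' : τ₁.vec n 2 = g := by rw [hg]; exact funext fun i => v₁ i i.2
  obtain ⟨f₂, v₂, l₂, g₂, t₂⟩ := run_matVec ω h₁ (show 2 ≠ 4 by norm_num) (by norm_num)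
  have h₂ := h₁.of_frame f₂ (fun a ha => by simp; omega) (fun a ha => by simp; omega)
  generalize (matVec 2 4).run ω τ₁ = τ₂ at *
  obtain ⟨f₃, u₃, v₃, l₃, g₃, t₃⟩ := run_termLoop ω h₂
  generalize (Program.loop 4 (nCell 6 3) termBody).run ω τ₂ = τ₃ at *
  have r5 : τ₂.real 5 = σ.real 5 := by rw [f₂.real 5 (by simp), f₁.real 5 (by simp)]
  have n6 : τ₂.nat 6 = σ.nat 6 := by rw [f₂.nat 6 (by simp), f₁.nat 6 (by simp)]
  rw [r5] at u₃
  rw [r5, n6, v₂, f₂.vec (a := 2) (by simp), v₁'] at v₃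
  rw [n6] at t₃
  refine ⟨((((Frame.refl _ _ σ).comp f₁).comp f₂).comp f₃).comp (frame_tick _ _), u₃, ?_,
    by simp [g₃, g₂, g₁], ?_⟩
  · refine v₃.trans (congrArg _ ?_)
    rw [Finset.range_eq_Ico, show Finset.Icc 1 (σ.nat 6 3)
      = Finset.Ico (0 + 1) (σ.nat 6 3 + 1) by ext; simp, ← Finset.sum_Ico_add']
    refine Finset.sum_congr rfl fun k _ => ?_
    -- Symmetry of `R` gives `gᵀ R y = (R g)ᵀ y`, so with `R g` stored each Taylor term needs a
    -- single product with `R`.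
    rw [← mulVec_mulVec, dotProduct_mulVec_symm hR.posSemidef.isHermitian]
    push_cast
    rfl
  · simp only [State.time_tick, t₃, t₂, t₁]; ring

/-- The Gaussian counter is `k * n` at the start of round `k`, so that round uses the `k`-th
Gaussian vector. -/
theorem run_traceProgram (ω : Tape) (hR : IsDensityMatrix R) (h : HasInput R e ℓ ε δ σ)
    (hga : σ.gaussians = 0) :
    let τ := traceProgram.run ω σ
    Frame {3, 4, 5} {2, 3, 4, 5} σ τ ∧ τ.real 5 3 = σ.real 5 3 ∧
      τ.real 5 4 = ∑ j : Fin (σ.nat 6 2), ∑ k ∈ Finset.Icc 1 (σ.nat 6 3),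
        (gaussVec n ω j ⬝ᵥ (R * (1 - (σ.real 5 3)⁻¹ • R) ^ k) *ᵥ gaussVec n ω j) / (k : ℝ) ∧
      τ.time = σ.time + 7 + σ.nat 6 2 * (15 + n * 9 + nnz R * 18 +
        σ.nat 6 3 * (32 + n * 32 + nnz R * 18)) := by
  have hrun : traceProgram.run ω σ = ((Program.loop 3 (nCell 6 2) traceBody).run ω
      ((Program.setReal 5 (.const 4) (.const 0)).run ω σ)).tick 1 := rfl
  have hrun₀ : (Program.setReal 5 (.const 4) (.const 0)).run ω σ = (σ.setReal 5 4 0).tick 3 := by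
    simp [Program.run, NatExpr.eval, RealExpr.eval, NatExpr.cost, RealExpr.cost]
  rw [hrun, hrun₀]
  set S : ℕ → ℝ := fun j => ∑ k ∈ Finset.Icc 1 (σ.nat 6 3),
    (gaussVec n ω j ⬝ᵥ (R * (1 - (σ.real 5 3)⁻¹ • R) ^ k) *ᵥ gaussVec n ω j) / (k : ℝ) with hS
  have key := run_loop_induction (ω := ω) (a := 3) (b := nCell 6 2) (p := traceBody)
    (σ := (σ.setReal 5 4 0).tick 3)
    (fun k τ => Frame {3, 4, 5} {2, 3, 4, 5} σ τ ∧ τ.real 5 3 = σ.real 5 3 ∧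
      τ.real 5 4 = ∑ j ∈ Finset.range k, S j ∧ τ.gaussians = k * n ∧
      τ.time = σ.time + 6 + k * (15 + n * 9 + nnz R * 18 +
        σ.nat 6 3 * (32 + n * 32 + nnz R * 18)))
    ⟨((Frame.refl _ _ σ).comp (frame_setReal 5 4 0 3 σ)).comp (frame_tick _ _),
      State.real_setReal_of_ne_index (a := 5) σ (0 : ℝ) (show 3 ≠ 4 by norm_num), by simp,
      by simp [hga], by simp [NatExpr.cost]⟩ ?_
  · have hev : NatExpr.eval ((σ.setReal 5 4 0).tick 3) (nCell 6 2) = σ.nat 6 2 := rfl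
    rw [hev] at key
    obtain ⟨k1, k2, k3, -, k5⟩ := key
    refine ⟨k1.comp (frame_tick _ _), k2, k3.trans (Finset.sum_range _), ?_⟩
    simp only [State.time_tick, k5]; ring
  · rintro k - τ ⟨k1, k2, k3, k4, k5⟩
    have f₀ : Frame {3, 4, 5} {2, 3, 4, 5} σ ((τ.setNat 3 0 k).tick 1) :=
      k1.comp (frame_setNat _ _ _ _ _)
    have h₀ := h.of_frame f₀ (fun a ha => by simp; omega) (fun a ha => by simp; omega)
    obtain ⟨m1, m2, m3, m4, m5⟩ := run_traceBody ω hR h₀ (g := gaussVec n ω k) (by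
      funext i; simp only [State.gaussians_tick, State.gaussians_setNat, k4]; rfl)
    have r₀ : ((τ.setNat 3 0 k).tick 1).real = τ.real := rfl
    have g₀ : ((τ.setNat 3 0 k).tick 1).gaussians = τ.gaussians := rfl
    have t₀ : ((τ.setNat 3 0 k).tick 1).time = τ.time + 1 := rfl
    rw [f₀.nat 6 (by simp)] at m3 m5
    rw [r₀, k2] at m2
    rw [r₀, k2, k3] at m3
    refine ⟨f₀.comp m1, m2, ?_, ?_, ?_⟩
    · rw [Finset.sum_range_succ]; exact m3
    · rw [m4, g₀, k4]; ring
    · rw [m5, t₀, k5]; ring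

/-! ### Correctness and running time of the program -/

theorem powerReps_pos {δ : ℝ} (hδ : 0 < δ) (hδ1 : δ < 1) : 0 < powerReps δ := by
  have : 0 < Real.log (1 / δ) := Real.log_pos (by rw [lt_div_iff₀ hδ]; linarith)
  exact Nat.ceil_pos.2 (by positivity)

theorem run_taylorProgram (ω : Tape) (hR : IsDensityMatrix R) (e : Fin (nnz R) ≃ NonzeroPos R)
    (hδ : 0 < δ) (hδ1 : δ < 1) :
    taylorProgram.output R e ℓ ε δ ω = randomEstimate R ℓ ε δ ω ∧
    taylorProgram.runtime R e ℓ ε δ ω ≤ 120 +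
      powerReps δ * (51 + n * 35 + nnz R * 18 + powerSteps n * (12 + n * 12 + nnz R * 18)) +
      numGaussians ε δ * (15 + n * 9 + nnz R * 18 +
        numTerms (randomUpper R δ ω) ℓ ε * (32 + n * 32 + nnz R * 18)) := by
  have h : HasInput R e ℓ ε δ (inputState R e ℓ ε δ) := ⟨fun _ _ => rfl, fun _ _ => rfl⟩
  have hfl : (inputState R e ℓ ε δ).flips = 0 := rfl
  have hga : (inputState R e ℓ ε δ).gaussians = 0 := rfl
  have hti : (inputState R e ℓ ε δ).time = 0 := rfl
  simp only [Program.output, Program.runtime, Program.final, taylorProgram, run_block_cons,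
    run_block_nil]
  generalize inputState R e ℓ ε δ = σ at *
  obtain ⟨f₁, q₁, s₁, n₁, l₁, g₁, t₁⟩ := run_setParameters ω h
  have h₁ := h.of_frame f₁ (fun a ha => by simp; omega) (fun a ha => by simp)
  generalize setParameters.run ω σ = τ₁ at *
  obtain ⟨f₂, v₂, g₂, t₂⟩ := run_powerProgram ω hR h₁ (by rw [q₁]; exact powerReps_pos hδ hδ1)
    (l₁.trans hfl)
  have h₂ := h₁.of_frame f₂ (fun a ha => by simp; omega) (fun a ha => by simp; omega)
  rw [q₁, s₁] at t₂
  have v₂' : min 1 (6 * (powerProgram.run ω τ₁).real 5 0) = randomUpper R δ ω := by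
    -- The number of starts also occurs in the index type of the family, so the equality is
    -- generalized and eliminated instead of rewritten.
    have hq : ∀ q, q = powerReps δ → min 1 (6 * powerEstimate R q (powerSteps n)
        fun j => signVec n ω j) = randomUpper R δ ω := by rintro _ rfl; rfl
    rw [v₂, s₁, hq _ q₁]
  have n₂ : (powerProgram.run ω τ₁).nat 6 2 = numGaussians ε δ := by
    rw [f₂.nat 6 (by simp), n₁]
  clear v₂
  generalize powerProgram.run ω τ₁ = τ₂ at *
  obtain ⟨f₃, u₃, n₃, m₃, g₃, t₃⟩ := run_setUpper ω h₂
  have h₃ := h₂.of_frame f₃ (fun a ha => by simp; omega) (fun a ha => by simp; omega)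
  rw [v₂'] at u₃ m₃
  rw [n₂] at n₃
  generalize setUpper.run ω τ₂ = τ₃ at *
  obtain ⟨f₄, u₄, v₄, t₄⟩ := run_traceProgram ω hR h₃ (by rw [g₃, g₂, g₁, hga])
  have n₄ : (traceProgram.run ω τ₃).nat 6 2 = numGaussians ε δ := by
    rw [f₄.nat 6 (by simp), n₃]
  rw [u₃] at u₄
  rw [n₃, m₃] at t₄
  have v₄' : (traceProgram.run ω τ₃).real 5 4 = ∑ j : Fin (numGaussians ε δ),
      ∑ k ∈ Finset.Icc 1 (numTerms (randomUpper R δ ω) ℓ ε), (gaussVec n ω j ⬝ᵥ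
        (R * (1 - (randomUpper R δ ω)⁻¹ • R) ^ k) *ᵥ gaussVec n ω j) / (k : ℝ) := by
    rw [v₄, u₃, m₃, ← Finset.sum_range (n := τ₃.nat 6 2) (fun j =>
      ∑ k ∈ Finset.Icc 1 (numTerms (randomUpper R δ ω) ℓ ε), (gaussVec n ω j ⬝ᵥ
        (R * (1 - (randomUpper R δ ω)⁻¹ • R) ^ k) *ᵥ gaussVec n ω j) / (k : ℝ)), n₃,
      Finset.sum_range]
  clear v₄
  generalize traceProgram.run ω τ₃ = τ₄ at *
  simp only [Program.run, NatExpr.eval, NatExpr.cost, RealExpr.eval, RealExpr.cost,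
    State.real_tick, State.real_setReal_self, State.time_tick, State.time_setReal, u₄, v₄', n₄]
  constructor
  · have : randomEstimate R ℓ ε δ ω = taylorSum R (randomUpper R δ ω)
        (numTerms (randomUpper R δ ω) ℓ ε) (numGaussians ε δ) fun j => gaussVec n ω j := by
      rw [randomEstimate, estimate, randomUpper]
    rw [this, taylorSum, Rat.cast_one, one_div, one_div, div_eq_inv_mul]
  · omega

end Program

/-! ### From step counts to the asymptotic running time -/

section Runtime

variable {n : ℕ} {R : Matrix (Fin n) (Fin n) ℝ}

theorem IsDensityMatrix.le_diag (hR : IsDensityMatrix R) {ℓ : ℝ} (h : ∀ i, ℓ ≤ hR.prob i)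
    (i : Fin n) : ℓ ≤ R i i := by
  set x : Fin n → ℝ := Pi.single i 1 with hx
  have h1 : x ⬝ᵥ x = 1 := by simp [hx]
  have h2 : x ⬝ᵥ R *ᵥ x = R i i := by simp [hx]
  rw [hR.dotProduct_eq_sum] at h1 h2
  rw [← h2, ← mul_one ℓ, ← h1, Finset.mul_sum]
  refine Finset.sum_le_sum fun k _ => ?_
  rw [hR.coord_mulVec]
  nlinarith [mul_le_mul_of_nonneg_right (h k) (mul_self_nonneg (hR.coord x k))]

/-- The diagonal entries are values of the quadratic form at unit vectors, hence at least `ℓ > 0`.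
This charges all work on vectors of length `n` to `nnz R`. -/
theorem IsDensityMatrix.le_nnz (hR : IsDensityMatrix R) {ℓ : ℝ} (hℓ : 0 < ℓ)
    (h : ∀ i, ℓ ≤ hR.prob i) : n ≤ nnz R := by
  have hinj : Function.Injective
      fun i : Fin n => (⟨(i, i), (hℓ.trans_le (hR.le_diag h i)).ne'⟩ : NonzeroPos R) := by
    intro i j hij
    simpa using hij
  simpa [nnz] using Nat.card_le_card_of_injective _ hinj

/-- Valid for every tape, since a sign vector is never zero. It gives `u / ℓ ≥ 1`, so the first
factor of the time bound is at least `ln (1/ε) / ε² + ln n`. -/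
theorem IsDensityMatrix.le_randomUpper (hR : IsDensityMatrix R) {ℓ δ : ℝ} (hℓ : 0 < ℓ)
    (h : ∀ i, ℓ ≤ hR.prob i) (hδ : 0 < δ) (hδ1 : δ < 1) (ω : Tape) :
    ℓ ≤ randomUpper R δ ω := by
  have hn : (n : ℝ) ≠ 0 := by exact_mod_cast hR.pos.ne'
  refine le_min ((h ⟨0, hR.pos⟩).trans (hR.prob_le_one _)) ?_
  have h1 := rayleigh_le_powerEstimate (R := R) (t := powerSteps n)
    (fun j : Fin (powerReps δ) => signVec n ω j) ⟨0, powerReps_pos hδ hδ1⟩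
  have h2 := hR.le_rayleigh hℓ h (powerSteps n) (x := signVec n ω 0)
    (by rw [show signVec n ω 0 ⬝ᵥ signVec n ω 0 = n from
      signOf_dotProduct_self fun i : Fin n => ω.1 (0 * n + i)]; exact hn)
  have h3 := h2.trans h1
  linarith

theorem log_four_mul_half_le (hn : 0 < n) : Real.log √(4 * (n : ℝ)) ≤ 1 + Real.log n := by
  have hn' : (1 : ℝ) ≤ n := by exact_mod_cast hn
  have h0 := Real.log_nonneg hn'
  have h2 := Real.log_two_lt_d9
  rw [Real.log_sqrt (by positivity), Real.log_mul (by norm_num) (by positivity),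
    show (4 : ℝ) = 2 ^ 2 by norm_num, Real.log_pow]
  push_cast
  linarith

/-- The constant in the running time bound. -/
def runtimeConst (a b : ℝ) : ℝ :=
  120 / (a * b) + (4.82 + 1 / a) * (104 / b + 42 * (2 / b + 1)) +
    (20 + 21 / a) * (168 / b + 82 * (1 + 4 / b))

/-- The time bound of the program in terms of the size of the input. Here `a` and `b` are lower
bounds on `ln (1/δ)` and on the first factor of the bound. -/
theorem time_bound {N : ℝ} {ν z q t s m : ℕ} {a b D X v L : ℝ} (ha : 0 < a) (hb : 0 < b)
    (haD : a ≤ D) (hbX : b ≤ X) (hν : (ν : ℝ) ≤ N) (hz : (z : ℝ) ≤ N) (hN : 1 ≤ N)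
    (hv : 0 ≤ v) (hL : 0 ≤ L) (hvL : v * L ≤ X) (hv1 : 1 ≤ v) (hvX : v ≤ 4 / b * X)
    (hq : (q : ℝ) ≤ 4.82 * D + 1) (ht : (t : ℝ) ≤ 2 + X) (hs : (s : ℝ) ≤ 20 * (1 + D) * v + 1)
    (hm : (m : ℝ) ≤ L + 1) :
    (120 + q * (51 + ν * 35 + z * 18 + t * (12 + ν * 12 + z * 18)) +
      s * (15 + ν * 9 + z * 18 + m * (32 + ν * 32 + z * 18)) : ℝ)
      ≤ runtimeConst a b * (X * D * N) := by
  have hD : 0 < D := ha.trans_le haD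
  have hX : 0 < X := hb.trans_le hbX
  have hN0 : 0 < N := by linarith
  -- In the application `D = ln (1/δ)`, `X` is the first factor, `v = 1/ε²`, `L = (u/ℓ) ln (1/ε)`
  -- and `N = nnz R`. Additive constants are absorbed through `1 ≤ D / a` and `1 ≤ X / b`.
  have hDa : 1 ≤ D / a := (one_le_div ha).2 haD
  have hXb : 1 ≤ X / b := (one_le_div hb).2 hbX
  have hq' : (q : ℝ) ≤ (4.82 + 1 / a) * D := by
    calc (q : ℝ) ≤ 4.82 * D + D / a := by linarith
      _ = _ := by ring
  have ht' : (t : ℝ) ≤ (2 / b + 1) * X := by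
    calc (t : ℝ) ≤ 2 * (X / b) + X := by linarith
      _ = _ := by ring
  have hs' : (s : ℝ) ≤ (20 + 21 / a) * D * v := by
    have h1 : (1 : ℝ) ≤ D / a * v := one_le_mul_of_one_le_of_one_le hDa hv1
    have h2 : v ≤ D / a * v := le_mul_of_one_le_left hv hDa
    calc (s : ℝ) ≤ 20 * (D / a * v + D * v) + D / a * v := by linarith
      _ = _ := by ring
  have h120 : (120 : ℝ) ≤ 120 / (a * b) * (X * D * N) := by
    have : (1 : ℝ) ≤ D / a * (X / b) * N := one_le_mul_of_one_le_of_one_le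
      (one_le_mul_of_one_le_of_one_le hDa hXb) hN
    calc (120 : ℝ) ≤ 120 * (D / a * (X / b) * N) := by linarith
      _ = _ := by field_simp
  have hpow : (q * (51 + ν * 35 + z * 18 + t * (12 + ν * 12 + z * 18)) : ℝ)
      ≤ (4.82 + 1 / a) * (104 / b + 42 * (2 / b + 1)) * (X * D * N) := by
    have h1 : (51 + ν * 35 + z * 18 : ℝ) ≤ 104 * (X / b) * N := by
      have : 104 * 1 * N ≤ 104 * (X / b) * N := by gcongr
      linarith
    have h2 : (12 + ν * 12 + z * 18 : ℝ) ≤ 42 * N := by linarith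
    calc (q * (51 + ν * 35 + z * 18 + t * (12 + ν * 12 + z * 18)) : ℝ)
        ≤ ((4.82 + 1 / a) * D) * (104 * (X / b) * N + ((2 / b + 1) * X) * (42 * N)) := by gcongr
      _ = _ := by ring
  have htr : (s * (15 + ν * 9 + z * 18 + m * (32 + ν * 32 + z * 18)) : ℝ)
      ≤ (20 + 21 / a) * (168 / b + 82 * (1 + 4 / b)) * (X * D * N) := by
    have h1 : (15 + ν * 9 + z * 18 : ℝ) ≤ 42 * N := by linarith
    have h2 : (32 + ν * 32 + z * 18 : ℝ) ≤ 82 * N := by linarith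
    calc (s * (15 + ν * 9 + z * 18 + m * (32 + ν * 32 + z * 18)) : ℝ)
        ≤ ((20 + 21 / a) * D * v) * (42 * N + (L + 1) * (82 * N)) := by gcongr
      -- The main term `v * L` is at most `X`. Rounding `m` up leaves a bare `v`, and this is where
      -- `hvX` is needed.
      _ = (20 + 21 / a) * D * N * (42 * v + 82 * (v * L + v)) := by ring
      _ ≤ (20 + 21 / a) * D * N * (42 * (4 / b * X) + 82 * (X + 4 / b * X)) := by gcongr
      _ = _ := by ring
  calc _ ≤ 120 / (a * b) * (X * D * N)
        + (4.82 + 1 / a) * (104 / b + 42 * (2 / b + 1)) * (X * D * N)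
        + (20 + 21 / a) * (168 / b + 82 * (1 + 4 / b)) * (X * D * N) := by linarith
    _ = _ := by rw [runtimeConst]; ring

theorem runtime_le {c : ℝ} (hc : c < 1) (hR : IsDensityMatrix R)
    (e : Fin (nnz R) ≃ NonzeroPos R) {ℓ ε δ : ℝ} (hℓ : 0 < ℓ) (hp : ∀ i, ℓ ≤ hR.prob i)
    (hε : 0 < ε) (hε1 : ε < 1) (hδ : 0 < δ) (hδc : δ ≤ c) (hnε : 2 ≤ n ∨ ε ≤ c) (ω : Tape) :
    (taylorProgram.runtime R e ℓ ε δ ω : ℝ) ≤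
      runtimeConst (Real.log (1 / c)) (min (Real.log 2) (Real.log (1 / c))) *
        ((randomUpper R δ ω / ℓ * (Real.log (1 / ε) / ε ^ 2) + Real.log n) * Real.log (1 / δ)
          * nnz R) := by
  -- For `c ≤ 0` the hypotheses on `δ` are contradictory, so any constant would do.
  have hc0 : 0 < c := hδ.trans_le hδc
  have hδ1 : δ < 1 := hδc.trans_lt hc
  set a := Real.log (1 / c) with hadef
  have ha : 0 < a := Real.log_pos (by rw [lt_div_iff₀ hc0]; linarith)
  have hlog2 : 0 < Real.log 2 := Real.log_pos (by norm_num)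
  set b := min (Real.log 2) a with hbdef
  have hb : 0 < b := lt_min hlog2 ha
  set w := randomUpper R δ ω / ℓ with hw
  have hw1 : 1 ≤ w := (one_le_div hℓ).2 (hR.le_randomUpper hℓ hp hδ hδ1 ω)
  have hlogε : 0 ≤ Real.log (1 / ε) := Real.log_nonneg (by rw [le_div_iff₀ hε]; linarith)
  have hn1 : (1 : ℝ) ≤ n := by exact_mod_cast hR.pos
  have hlogn : 0 ≤ Real.log n := Real.log_nonneg hn1
  have hv1 : 1 ≤ 1 / ε ^ 2 := by
    rw [one_le_div (by positivity)]; exact pow_le_one₀ hε.le hε1.le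
  have hwL : Real.log (1 / ε) ≤ w * Real.log (1 / ε) := le_mul_of_one_le_left hlogε hw1
  have hwL0 : 0 ≤ w * Real.log (1 / ε) := hlogε.trans hwL
  set X := w * (Real.log (1 / ε) / ε ^ 2) + Real.log n with hX
  have hXeq : X = 1 / ε ^ 2 * (w * Real.log (1 / ε)) + Real.log n := by rw [hX]; ring
  have hXle : 1 / ε ^ 2 * Real.log (1 / ε) ≤ X := by
    rw [hXeq]
    have := mul_le_mul_of_nonneg_left hwL (zero_le_one.trans hv1)
    linarith
  have hXn : Real.log n ≤ X := by
    rw [hXeq]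
    have := mul_nonneg (zero_le_one.trans hv1) hwL0
    linarith
  -- If `n = 1` and `ε` tends to `1`, the first factor can tend to zero while the program still
  -- takes some steps. The alternative `2 ≤ n ∨ ε ≤ c` excludes this.
  have hbX : b ≤ X := by
    rcases hnε with h2 | hεc
    · refine (min_le_left _ _).trans (le_trans ?_ hXn)
      exact Real.log_le_log (by norm_num) (by exact_mod_cast h2)
    · refine (min_le_right _ _).trans (le_trans ?_ hXle)
      have h3 : a ≤ Real.log (1 / ε) :=
        Real.log_le_log (by positivity) (one_div_le_one_div_of_le hε hεc)
      exact h3.trans (le_mul_of_one_le_left hlogε hv1)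
  -- For `ε ≤ 1/2` the logarithm is at least `ln 2 ≥ b`, so `X ≥ b / ε²`; for `ε > 1/2` one has `1 /
  -- ε² ≤ 4` and `X ≥ b`.
  have hvX : 1 / ε ^ 2 ≤ 4 / b * X := by
    rw [div_mul_eq_mul_div, le_div_iff₀ hb]
    rcases le_or_gt ε (1 / 2) with h | h
    · have h1 : b ≤ Real.log (1 / ε) := (min_le_left _ _).trans
        (Real.log_le_log (by norm_num) (by rw [le_div_iff₀ hε]; linarith))
      have h2 := mul_le_mul_of_nonneg_left h1 (zero_le_one.trans hv1)
      have h3 : 0 ≤ X := hb.le.trans hbX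
      linarith
    · have h1 : 1 / ε ^ 2 ≤ 4 := by
        rw [div_le_iff₀ (by positivity)]; nlinarith
      exact mul_le_mul h1 hbX hb.le (by norm_num)
  have haD : a ≤ Real.log (1 / δ) :=
    Real.log_le_log (by positivity) (one_div_le_one_div_of_le hδ hδc)
  have hD0 : 0 ≤ Real.log (1 / δ) := ha.le.trans haD
  have hnnz : (n : ℝ) ≤ nnz R := by exact_mod_cast hR.le_nnz hℓ hp
  have hrun := (run_taylorProgram (ℓ := ℓ) (ε := ε) ω hR e hδ hδ1).2
  refine le_trans (Nat.cast_le.2 hrun) ?_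
  push_cast
  refine time_bound (v := 1 / ε ^ 2) (L := w * Real.log (1 / ε)) ha hb haD hbX hnnz le_rfl
    (hn1.trans hnnz) (zero_le_one.trans hv1) hwL0 (by linarith) hv1 hvX ?_ ?_ ?_ ?_
  · exact (Nat.ceil_lt_add_one (by positivity)).le
  · have h0 : 0 ≤ Real.log √(4 * (n : ℝ)) :=
      Real.log_nonneg (Real.one_le_sqrt.2 (by linarith))
    have h1 : (powerSteps n : ℝ) ≤ Real.log √(4 * (n : ℝ)) + 1 := (Nat.ceil_lt_add_one h0).le
    have h2 := log_four_mul_half_le hR.pos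
    linarith
  · have h2 : Real.log (2 / δ) ≤ 1 + Real.log (1 / δ) := by
      rw [show 2 / δ = 2 * (1 / δ) by ring, Real.log_mul (by norm_num) (by positivity)]
      linarith [Real.log_two_lt_d9]
    have h3 : 0 ≤ Real.log (2 / δ) := Real.log_nonneg (by rw [le_div_iff₀ hδ]; linarith)
    have h4 : (numGaussians ε δ : ℝ) ≤ 20 * Real.log (2 / δ) / ε ^ 2 + 1 :=
      (Nat.ceil_lt_add_one (by positivity)).le
    have h5 : 20 * Real.log (2 / δ) / ε ^ 2 ≤ 20 * (1 + Real.log (1 / δ)) * (1 / ε ^ 2) := by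
      rw [mul_one_div]; gcongr
    linarith
  · exact (Nat.ceil_lt_add_one hwL0).le

end Runtime

end

end EntropyTaylor

theorem mainTheorem1 :
    -- accuracy of the estimator
    (∀ (n : ℕ) (R : Matrix (Fin n) (Fin n) ℝ) (hR : EntropyTaylor.IsDensityMatrix R) (ℓ ε δ : ℝ),
      0 < ℓ → (∀ i, ℓ ≤ hR.prob i) → 0 < ε → ε < 1 → 0 < δ → δ < 1 →
        1 - 2 * δ ≤ EntropyTaylor.tapeMeasure.real
          {ω | |EntropyTaylor.randomEstimate R ℓ ε δ ω - hR.entropy| ≤ 2 * ε * hR.entropy}) ∧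
    -- the program computes the estimator
    (∀ (n : ℕ) (R : Matrix (Fin n) (Fin n) ℝ) (hR : EntropyTaylor.IsDensityMatrix R)
      (e : Fin (EntropyTaylor.nnz R) ≃ EntropyTaylor.NonzeroPos R) (ℓ ε δ : ℝ),
      0 < ℓ → (∀ i, ℓ ≤ hR.prob i) → 0 < ε → ε < 1 → 0 < δ → δ < 1 →
        ∀ ω, EntropyTaylor.taylorProgram.output R e ℓ ε δ ω
          = EntropyTaylor.randomEstimate R ℓ ε δ ω) ∧
    -- the running time of the program
    (∀ c : ℝ, c < 1 → ∃ C : ℝ,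
      ∀ (n : ℕ) (R : Matrix (Fin n) (Fin n) ℝ) (hR : EntropyTaylor.IsDensityMatrix R)
        (e : Fin (EntropyTaylor.nnz R) ≃ EntropyTaylor.NonzeroPos R) (ℓ ε δ : ℝ),
        0 < ℓ → (∀ i, ℓ ≤ hR.prob i) → 0 < ε → ε < 1 → 0 < δ → δ ≤ c → (2 ≤ n ∨ ε ≤ c) →
          ∀ ω, (EntropyTaylor.taylorProgram.runtime R e ℓ ε δ ω : ℝ) ≤
            C * ((EntropyTaylor.randomUpper R δ ω / ℓ * (Real.log (1 / ε) / ε ^ 2)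
                + Real.log n) * Real.log (1 / δ) * EntropyTaylor.nnz R)) := by
  exact ⟨fun _ _ hR _ _ _ hℓ hp hε hε1 hδ hδ1 =>
      EntropyTaylor.accuracy hR hℓ hp hε hε1 hδ hδ1,
    fun _ _ hR e _ _ _ _ _ _ _ hδ hδ1 ω => (EntropyTaylor.run_taylorProgram ω hR e hδ hδ1).1,
    fun _ hc => ⟨_, fun _ _ hR e _ _ _ hℓ hp hε hε1 hδ hδc hnε ω =>
      EntropyTaylor.runtime_le hc hR e hℓ hp hε hε1 hδ hδc hnε ω⟩⟩
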